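/- **Setting.** Let $K\ge 1$, let $\mathcal X$ be a measurable space and $D$ a probability distribution on $\mathcal X\times\mathbb R^K$ under which the loss vector lies in $[0,1]^K$ almost surely. Let $\Pi$ be a finite set of measurable policies $\pi:\mathcal X\to\{1,\dots,K\}$, $L(\pi)=\mathbb E_{(x,\ell)\sim D}[\ell(\pi(x))]$, $\pi^*\in\arg\min_{\pi\in\Pi}L(\pi)$, $\rho(\pi,\pi')=P_x(\pi(x)\ne\pi'(x))$, and $$\theta=\sup_{r>0}\frac1r\,P_x\big(\exists \pi\in\Pi:\ \rho(\pi,\pi^*)\le r,\ \pi(x)\ne\pi^*(x)\big).$$ Let $(x_t,\ell_t)_{t\ge1}$ be drawn from $D$, each independently of the past. For $\delta\in(0,1)$ and $\epsilon\in(0,1]$ put $\delta_T=\delta/(T^2+T)$, $e_T=2\log(2|\Pi|/\delta_T)/T$ for $T\ge1$, $e_0=0$, and $$\Delta_t=\Big(\sqrt{2K/\epsilon}+1\Big)\sqrt{e_{t-1}}+\Big(\frac K\epsilon+3\Big)e_{t-1}.$$ For a finite sample $Z$ of pairs (context, cost vector) let $L(\pi,Z)$ be the average of $c(\pi(x))$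 over $(x,c)\in Z$ (and $0$ if $Z$ is empty). **Algorithm (active $\epsilon$-greedy).** Start with the empty sample $\hat Z_0$. In round $t=1,2,\dots$ observe $x_t$; let $\pi_t$ minimize $L(\cdot,\hat Z_{t-1})$ over $\Pi$ (ties broken using only the past) and, for each action $a$ selected at $x_t$ by some policy of $\Pi$, let $\pi_{t,a}$ minimize $L(\cdot,\hat Z_{t-1})$ over $\{\pi\in\Pi:\pi(x_t)=a\}$; let $A_t$ be the set of those $a$ with $L(\pi_{t,a},\hat Z_{t-1})-L(\pi_t,\hat Z_{t-1})\le\Delta_t$. Given the past, $x_t$ and $\ell_t$, play $a_t$ with distribution $p_t$, where $p_t(\pi_t(x_t))=1-(|A_t|-1)\epsilon/K$, $p_t(a)=\epsilon/K$ for $a\in A_t\setminus\{\pi_t(x_t)\}$, and $p_t(a)=0$ otherwise. Observe $\ell_t(a_t)$ and let $\hat Z_t$ be $\hat Z_{t-1}$ with $(x_t,\hat\ell_t)$ added, where $\hat\ell_t(a)=\mathbf 1\{a=a_t\}\,\ell_t(a_t)/p_t(a_t)$ if $a\in A_t$ and $\hat\ell_t(a)=1$ otherwise. Let $\tilde\ell_t(a)=\ell_t(a)$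 if $a\in A_t$ and $\tilde\ell_t(a)=1$ otherwise, and let $L_T,\tilde L_T,\hat L_T$ be the averages of $\ell_t(\pi(x_t))$, $\tilde\ell_t(\pi(x_t))$, $\hat\ell_t(\pi(x_t))$ over $t\le T$. The regret is $R_T=\sum_{t=1}^T\big(\ell_t(a_t)-\ell_t(\pi^*(x_t))\big)$. Let $\mathcal E$ be the event that for all $\pi\in\Pi$ and all $T\ge1$ $$\big|(\hat L_T(\pi)-\hat L_T(\pi^*))-(\tilde L_T(\pi)-\tilde L_T(\pi^*))\big|\le\sqrt{2K\rho(\pi,\pi^*)e_T/\epsilon}+\Big(\frac K\epsilon+1\Big)e_T,$$ $$\big|(L_T(\pi)-L_T(\pi^*))-(L(\pi)-L(\pi^*))\big|\le\sqrt{\rho(\pi,\pi^*)e_T}+2e_T.$$ **Theorem.** There is a universal constant $C>0$ such that the following holds for all $T\ge2$ and $\delta\in(0,1)$, whenever the Massart condition $\rho(\pi,\pi^*)\le\frac1\tau(L(\pi)-L(\pi^*))$ for all $\pi\in\Pi$ holds with parameter $\tau>0$. 1. For every $\epsilon\in(0,1]$, $P(\mathcal E)\ge1-\delta$ and $$\mathbb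 E[R_T\mid\mathcal E]\le C\left(\frac{K\log(T|\Pi|/\delta)}{\tau\epsilon}\log T+\frac\theta\tau\sqrt{\epsilon KT\log(T|\Pi|/\delta)}\right).$$ 2. There is a choice of $\epsilon\in(0,1]$, depending only on $K,|\Pi|,T,\delta,\theta$, for which $$\mathbb E[R_T\mid\mathcal E]\le\frac C\tau\,\big(\theta K\log(T|\Pi|/\delta)\big)^{2/3}(T\log T)^{1/3}.$$ -/

import Mathlib

open MeasureTheory ProbabilityTheory

noncomputable section

namespace ActiveGreedy

/-- A stochastic contextual bandit problem with context space `X` and `K` actions: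
data distribution `D` on pairs (context, loss vector) with losses in `[0, 1]`, a finite class
`Pol` of measurable policies, and an optimal policy `opt` in the class. -/
structure Problem (X : Type*) [MeasurableSpace X] (K : ℕ) where
  D : Measure (X × (Fin K → ℝ))
  isProb : IsProbabilityMeasure D
  loss_mem : ∀ᵐ z ∂D, ∀ a, z.2 a ∈ Set.Icc (0 : ℝ) 1
  Pol : Finset (X → Fin K)
  measurable_pol : ∀ π ∈ Pol, Measurable π
  opt : X → Fin K
  opt_mem : opt ∈ Pol
  opt_min : ∀ π ∈ Pol, ∫ z, z.2 (opt z.1) ∂D ≤ ∫ z, z.2 (π z.1) ∂D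

namespace Problem

variable {X : Type*} [MeasurableSpace X] {K : ℕ} (B : Problem X K)

/-- Expected loss `L(π)`. -/
def risk (π : X → Fin K) : ℝ := ∫ z, z.2 (π z.1) ∂B.D

/-- Marginal distribution of the contexts. -/
def ctxLaw : Measure X := B.D.map Prod.fst

/-- Expected disagreement `ρ(π, π')`. -/
def rho (π π' : X → Fin K) : ℝ := B.ctxLaw.real {x | π x ≠ π' x}

/-- The Massart noise condition with parameter `τ`. -/
def Massart (τ : ℝ) : Prop :=
  0 < τ ∧ ∀ π ∈ B.Pol, B.rho π B.opt ≤ 1 / τ * (B.risk π - B.risk B.opt)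

/-- The disagreement region of radius `r` around the optimal policy. -/
def disRegion (r : ℝ) : Set X := {x | ∃ π ∈ B.Pol, B.rho π B.opt ≤ r ∧ π x ≠ B.opt x}

/-- The disagreement coefficient `θ = sup_{r > 0} P(x ∈ DIS(r)) / r`. For a finite class the
supremum is over a set bounded by the number of policies, so the real supremum is the true one. -/
def disCoeff : ℝ := ⨆ r : Set.Ioi (0 : ℝ), B.ctxLaw.real (B.disRegion r) / (r : ℝ)

end Problem

/-- `δ_T = δ / (T² + T)`. -/
def deltaT (δ : ℝ) (T : ℕ) : ℝ := δ / ((T : ℝ) ^ 2 + T)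

/-- `e_T = 2 log (2 N / δ_T) / T`, with `N` the number of policies (and `e_0 = 0`). -/
def eT (N : ℕ) (δ : ℝ) (T : ℕ) : ℝ := 2 * Real.log (2 * N / deltaT δ T) / T

/-- The threshold `Δ_t` of the algorithm, for rounds `t ≥ 1`. At `t = 1` there are no data, all
empirical losses vanish, and the value `Δ_1 = 0` keeps every action that some policy selects. -/
def threshold (K N : ℕ) (ε δ : ℝ) (t : ℕ) : ℝ :=
  (Real.sqrt (2 * K / ε) + 1) * Real.sqrt (eT N δ (t - 1)) + (K / ε + 3) * eT N δ (t - 1)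

section Algorithm

variable {X : Type*} {K : ℕ}

/-- Empirical loss `L(π, Z)` of a policy on a sample of (context, cost vector) pairs;
it is `0` on the empty sample. -/
def empLoss (Z : List (X × (Fin K → ℝ))) (π : X → Fin K) : ℝ :=
  (Z.map fun z => z.2 (π z.1)).sum / Z.length

/-- `π` is an output of the exact cost-sensitive oracle on the sample `Z`, with the search
restricted to the policies of `Pol` that satisfy `p`. -/
def IsOracle (Pol : Finset (X → Fin K)) (p : (X → Fin K) → Prop)
    (Z : List (X × (Fin K → ℝ))) (π : X → Fin K) : Prop :=
  π ∈ Pol ∧ p π ∧ ∀ π' ∈ Pol, p π' → empLoss Z π ≤ empLoss Z π'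

open Classical in
/-- The set `A_t` of explored actions, for the current sample `Z`, current policy `πt`, current
context `x` and threshold `Δ`. An action that no policy selects at `x` is not explored. -/
def exploreSet (Pol : Finset (X → Fin K)) (Δ : ℝ) (Z : List (X × (Fin K → ℝ)))
    (πt : X → Fin K) (x : X) : Finset (Fin K) :=
  {a | ∃ π, IsOracle Pol (fun π' => π' x = a) Z π ∧ empLoss Z π - empLoss Z πt ≤ Δ}

/-- The probabilities `p_t`, where `b` is the action of the current policy. -/
def playProb (ε : ℝ) (A : Finset (Fin K)) (b a : Fin K) : ℝ :=
  if a = b then 1 - ((A.card : ℝ) - 1) * ε / K else if a ∈ A then ε / K else 0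

/-- A deterministic record of an interaction: contexts, (full) loss vectors, played actions and
the policies `π_t` of the algorithm, at rounds `t = 1, 2, …` (the entries at `0` are unused). -/
structure Transcript (X : Type*) (K : ℕ) where
  ctx : ℕ → X
  loss : ℕ → Fin K → ℝ
  act : ℕ → Fin K
  pol : ℕ → X → Fin K

namespace Transcript

variable (Pol : Finset (X → Fin K)) (ε δ : ℝ) (S : Transcript X K)

/-- The set `A_t` when the current sample is `Z`. -/
def setAt (Z : List (X × (Fin K → ℝ))) (t : ℕ) : Finset (Fin K) :=
  exploreSet Pol (threshold K Pol.card ε δ t) Z (S.pol t) (S.ctx t)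

/-- The estimated cost vector of round `t` when the current sample is `Z`: inverse propensity
scores of the observed loss on the explored actions, and `1` on the others. -/
def hatLossAt (Z : List (X × (Fin K → ℝ))) (t : ℕ) (a : Fin K) : ℝ :=
  if a ∈ setAt Pol ε δ S Z t then
    (if a = S.act t then
      S.loss t (S.act t) /
        playProb ε (setAt Pol ε δ S Z t) (S.pol t (S.ctx t)) (S.act t)
    else 0)
  else 1

/-- The sample the algorithm has built by the end of round `t`. -/
def hatSample : ℕ → List (X × (Fin K → ℝ))
  | 0 => []
  | t + 1 => hatSample t ++ [(S.ctx (t + 1), hatLossAt Pol ε δ S (hatSample t) (t + 1))]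

/-- The set `A_t` of explored actions at round `t ≥ 1`. -/
def explored (t : ℕ) : Finset (Fin K) := setAt Pol ε δ S (hatSample Pol ε δ S (t - 1)) t

/-- The distribution `p_t` of the action at round `t ≥ 1`. -/
def prob (t : ℕ) (a : Fin K) : ℝ :=
  playProb ε (explored Pol ε δ S t) (S.pol t (S.ctx t)) a

/-- The biased loss vector of round `t`: true losses on explored actions, `1` on the others. -/
def tildeLoss (t : ℕ) (a : Fin K) : ℝ := if a ∈ explored Pol ε δ S t then S.loss t a else 1

/-- The biased sample of rounds `1, …, T`. -/
def tildeSample (T : ℕ) : List (X × (Fin K → ℝ)) :=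
  (List.range T).map fun s => (S.ctx (s + 1), tildeLoss Pol ε δ S (s + 1))

/-- The (unobserved) true sample of rounds `1, …, T`. -/
def trueSample (T : ℕ) : List (X × (Fin K → ℝ)) :=
  (List.range T).map fun s => (S.ctx (s + 1), S.loss (s + 1))

/-- The regret `R_T` with respect to the policy `π`. -/
def regret (π : X → Fin K) (T : ℕ) : ℝ :=
  ∑ t ∈ Finset.Icc 1 T, (S.loss t (S.act t) - S.loss t (π (S.ctx t)))

end Transcript

end Algorithm

section Run

variable {X : Type*} [MeasurableSpace X] {K : ℕ} {Ω : Type*} [mΩ : MeasurableSpace Ω]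

/-- The random transcript `S` is a run of the active `ε`-greedy algorithm on the problem `B`.
The σ-algebra `𝓕 t` is the information at the end of round `t` (ties of the oracle may be broken
in any way that uses only the past). -/
structure IsRun (B : Problem X K) (ε δ : ℝ) (μ : Measure Ω) (𝓕 : Filtration ℕ mΩ)
    (S : Ω → Transcript X K) : Prop where
  ctx_meas : ∀ t, Measurable[𝓕 (t + 1)] fun ω => (S ω).ctx (t + 1)
  loss_meas : ∀ t, Measurable[𝓕 (t + 1)] fun ω => (S ω).loss (t + 1)
  act_meas : ∀ t, Measurable[𝓕 (t + 1)] fun ω => (S ω).act (t + 1)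
  /-- the pair `(x_t, ℓ_t)` is drawn from `D`, -/
  law : ∀ t, μ.map (fun ω => ((S ω).ctx (t + 1), (S ω).loss (t + 1))) = B.D
  /-- independently of the past; -/
  indep : ∀ t, Indep (MeasurableSpace.comap
    (fun ω => ((S ω).ctx (t + 1), (S ω).loss (t + 1))) inferInstance) (𝓕 t) μ
  /-- `π_t` is determined by the past, -/
  pol_meas : ∀ t, ∀ π ∈ B.Pol, MeasurableSet[𝓕 t] {ω | (S ω).pol (t + 1) = π}
  /-- and it minimizes the empirical loss on the sample built so far; -/
  pol_oracle : ∀ t ω, IsOracle B.Pol (fun _ => True)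
    (Transcript.hatSample B.Pol ε δ (S ω) t) ((S ω).pol (t + 1))
  /-- given the past, `x_t` and `ℓ_t`, the action `a_t` has distribution `p_t`. -/
  act_law : ∀ t a,
    μ[fun ω => if (S ω).act (t + 1) = a then (1 : ℝ) else 0 |
        𝓕 t ⊔ MeasurableSpace.comap
          (fun ω => ((S ω).ctx (t + 1), (S ω).loss (t + 1))) inferInstance]
      =ᵐ[μ] fun ω => Transcript.prob B.Pol ε δ (S ω) (t + 1) a

/-- The event `𝓔` that the deviation bounds hold for all policies and all `T ≥ 1`. -/
def goodEvent (B : Problem X K) (ε δ : ℝ) (S : Ω → Transcript X K) : Set Ω :=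
  {ω | ∀ π ∈ B.Pol, ∀ T : ℕ, 1 ≤ T →
    |(empLoss (Transcript.hatSample B.Pol ε δ (S ω) T) π
        - empLoss (Transcript.hatSample B.Pol ε δ (S ω) T) B.opt)
      - (empLoss (Transcript.tildeSample B.Pol ε δ (S ω) T) π
        - empLoss (Transcript.tildeSample B.Pol ε δ (S ω) T) B.opt)|
      ≤ Real.sqrt (2 * K * B.rho π B.opt * eT B.Pol.card δ T / ε)
        + (K / ε + 1) * eT B.Pol.card δ T ∧
    |(empLoss ((S ω).trueSample T) π - empLoss ((S ω).trueSample T) B.opt)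
      - (B.risk π - B.risk B.opt)|
      ≤ Real.sqrt (B.rho π B.opt * eT B.Pol.card δ T) + 2 * eT B.Pol.card δ T}

end Run

end ActiveGreedy

end

noncomputable section

namespace ActiveGreedy

/-! ### Bernstein's inequality for bounded martingale differences. -/

section Bernstein

/-! Unexplored actions are charged cost 1. While the action of the optimal policy stays explored,
this bias can only hurt its competitors, so the true empirical difference to the optimal policy is
at most the biased one (`trueDiff_le_tildeDiff`), and the deviation bounds turn a small estimated
gap into a small excess risk (`risk_sub_le`). The elimination threshold is the total deviation width
at the largest possible distance 1, so by induction the optimal action is never eliminated on the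
good event (`opt_mem_explored`).

Write q = K e_n / ε. The empirical minimizer has excess risk of order √(ρq) + q, where ρ is its
distance to the optimal policy. Massart bounds ρ by the excess risk over τ, and solving the
self-bounding inequality gives order q/τ (`risk_pol_sub_le`); summing 1/n yields the log T term. A
policy that keeps an alternative action explored has excess risk of order √q, hence distance of
order √q/τ, so real choices occur only in a disagreement region of probability of order θ√q/τ
(`ctx_mem_disRegion`). Leaving the current policy has probability at most ε there, and ε√q = √(εK
e_n) sums to the √T term.

The deviation bounds are a martingale Bernstein inequality and a union bound over policies and
times. The variance carries the factor ρ because two policies contribute nothing on contexts where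
they agree, and K/ε is the price of inverse propensity weights. For T ≤ 3 the widths already exceed
the trivial bounds, so the good event has probability at least 1 - δ/2 ≥ 1/2, and conditioning on it
costs a factor 2 uniformly in δ.

The good event depends on the future, so at round n + 1 it is replaced by the larger event
`goodUpTo` n, which is known at time n; the difference has probability at most 2δ/(n+1), no larger
than the other terms (`setIntegral_roundRegret_le`).

If some policy has positive distance to the optimal one, then τ ≤ 1 and θ ≥ 1; otherwise the regret
vanishes almost surely. The tuned ε equates the two terms. When that value exceeds 1, ε = 1 is used,
and the bound min(1, x) ≤ x^(2/3) on the per-round estimation term still gives the rate. -/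

/-- The quadratic upper bound on the exponential behind Bernstein's inequality. -/
lemma exp_le_one_add_add_sq {c y : ℝ} (hc0 : 0 ≤ c) (hc : c < 1) (hy : y ≤ c) :
    Real.exp y ≤ 1 + y + y ^ 2 / (2 * (1 - c)) := by
  have h1 : 0 < 1 - c := by linarith
  -- The sign of g' is that of y (c - y/2), so g decreases up to 0, increases on [0, c], and has
  -- minimum g 0 = 1.
  set g : ℝ → ℝ := fun y => (1 + y + y ^ 2 / (2 * (1 - c))) * Real.exp (-y) with hg
  have hd : ∀ y, HasDerivAt g (Real.exp (-y) * (y / (1 - c)) * (c - y / 2)) y := by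
    intro y
    have e1 : HasDerivAt (fun y : ℝ => 1 + y + y ^ 2 / (2 * (1 - c)))
        (1 + (2 * y) / (2 * (1 - c))) y := by
      have := ((hasDerivAt_id y).const_add 1).add (((hasDerivAt_id y).pow 2).div_const (2 * (1 - c)))
      refine this.congr_deriv ?_
      simp
    have e2 : HasDerivAt (fun y : ℝ => Real.exp (-y)) (-Real.exp (-y)) y := by
      have := (hasDerivAt_neg y).exp
      convert this using 1
      ring
    have := e1.mul e2
    refine this.congr_deriv ?_
    have h1' : 1 - c ≠ 0 := h1.ne'
    field_simp
    ring
  have hcont : Continuous g := continuous_iff_continuousAt.2 fun y => (hd y).continuousAt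
  have key : 1 ≤ g y := by
    have g0 : g 0 = 1 := by simp [hg]
    rcases le_total 0 y with h0 | h0
    · have : MonotoneOn g (Set.Icc 0 c) := by
        refine monotoneOn_of_deriv_nonneg (convex_Icc _ _) hcont.continuousOn
          (fun x _ => (hd x).differentiableAt.differentiableWithinAt) fun x hx => ?_
        rw [interior_Icc] at hx
        rw [(hd x).deriv]
        exact mul_nonneg (mul_nonneg (Real.exp_pos _).le (div_nonneg hx.1.le h1.le))
          (by linarith [hx.1, hx.2])
      have := this ⟨le_rfl, hc0⟩ ⟨h0, hy⟩ h0
      linarith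
    · have : AntitoneOn g (Set.Iic 0) := by
        refine antitoneOn_of_deriv_nonpos (convex_Iic _) hcont.continuousOn
          (fun x _ => (hd x).differentiableAt.differentiableWithinAt) fun x hx => ?_
        rw [interior_Iic] at hx
        rw [(hd x).deriv]
        exact mul_nonpos_of_nonpos_of_nonneg
          (mul_nonpos_of_nonneg_of_nonpos (Real.exp_pos _).le
            (div_nonpos_of_nonpos_of_nonneg (le_of_lt hx) h1.le))
          (by linarith [Set.mem_Iio.1 hx])
      have := this (Set.mem_Iic.2 h0) (Set.mem_Iic.2 le_rfl) h0
      linarith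
  have h2 : Real.exp (-y) * Real.exp y = 1 := by rw [← Real.exp_add]; simp
  calc Real.exp y = 1 * Real.exp y := (one_mul _).symm
    _ ≤ g y * Real.exp y := mul_le_mul_of_nonneg_right key (Real.exp_pos _).le
    _ = 1 + y + y ^ 2 / (2 * (1 - c)) := by rw [hg]; simp only; rw [mul_assoc, h2, mul_one]

variable {Ω : Type*} [mΩ : MeasurableSpace Ω] {μ : Measure Ω}

lemma integral_mul_eq_integral_mul_condExp [IsProbabilityMeasure μ] {m : MeasurableSpace Ω}
    (hm : m ≤ mΩ) {W Y : Ω → ℝ} {C : ℝ} (hW : Measurable[m] W)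
    (hWb : ∀ᵐ ω ∂μ, |W ω| ≤ C) (hY : Integrable Y μ) :
    ∫ ω, W ω * Y ω ∂μ = ∫ ω, W ω * (μ[Y | m]) ω ∂μ := by
  have hWY : Integrable (W * Y) μ :=
    hY.bdd_mul (hW.mono hm le_rfl).aestronglyMeasurable hWb
  have := condExp_mul_of_stronglyMeasurable_left hW.stronglyMeasurable hWY hY
  calc ∫ ω, W ω * Y ω ∂μ = ∫ ω, (μ[W * Y | m]) ω ∂μ := (integral_condExp hm).symm
    _ = _ := integral_congr_ae this

/-- `Y` is a sequence of martingale differences bounded by `b` with conditional second moments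
bounded by `v`. -/
structure IsBoundedMartingaleDiff (μ : Measure Ω) (𝓕 : Filtration ℕ mΩ) (Y : ℕ → Ω → ℝ)
    (b v : ℝ) : Prop where
  meas : ∀ n, Measurable[𝓕 (n + 1)] (Y n)
  bound : ∀ n, ∀ᵐ ω ∂μ, |Y n ω| ≤ b
  mean : ∀ n, μ[Y n | 𝓕 n] =ᵐ[μ] 0
  var : ∀ n, μ[fun ω => Y n ω ^ 2 | 𝓕 n] ≤ᵐ[μ] fun _ => v

namespace IsBoundedMartingaleDiff

variable {𝓕 : Filtration ℕ mΩ} {Y : ℕ → Ω → ℝ} {b v : ℝ}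

lemma neg (h : IsBoundedMartingaleDiff μ 𝓕 Y b v) :
    IsBoundedMartingaleDiff μ 𝓕 (fun n ω => -Y n ω) b v where
  meas n := (h.meas n).neg
  bound n := by simpa using h.bound n
  mean n := by
    have h1 := condExp_neg (μ := μ) (Y n) (𝓕 n)
    have h2 := h.mean n
    filter_upwards [h1, h2] with ω h1 h2
    have : (μ[fun ω => -Y n ω | 𝓕 n]) ω = -(μ[Y n | 𝓕 n]) ω := h1
    rw [this, h2]; simp
  var n := by simpa using h.var n

lemma measurable_sum (h : IsBoundedMartingaleDiff μ 𝓕 Y b v) (n : ℕ) :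
    Measurable[𝓕 n] (fun ω => ∑ k ∈ Finset.range n, Y k ω) := by
  refine Finset.measurable_sum _ fun k hk => (h.meas k).mono (𝓕.mono ?_) le_rfl
  have := Finset.mem_range.1 hk
  omega

lemma abs_sum_le (h : IsBoundedMartingaleDiff μ 𝓕 Y b v) (n : ℕ) :
    ∀ᵐ ω ∂μ, |∑ k ∈ Finset.range n, Y k ω| ≤ n * b := by
  have := ae_all_iff.2 h.bound
  filter_upwards [this] with ω hω
  calc |∑ k ∈ Finset.range n, Y k ω| ≤ ∑ k ∈ Finset.range n, |Y k ω| :=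
        Finset.abs_sum_le_sum_abs _ _
    _ ≤ ∑ _k ∈ Finset.range n, b := Finset.sum_le_sum fun k _ => hω k
    _ = n * b := by simp

lemma abs_exp_sum_le (h : IsBoundedMartingaleDiff μ 𝓕 Y b v) {s : ℝ} (hs : 0 ≤ s) (n : ℕ) :
    ∀ᵐ ω ∂μ, |Real.exp (s * ∑ k ∈ Finset.range n, Y k ω)| ≤ Real.exp (s * (n * b)) := by
  filter_upwards [h.abs_sum_le n] with ω hω
  rw [abs_of_pos (Real.exp_pos _)]
  exact Real.exp_le_exp.2 (mul_le_mul_of_nonneg_left ((le_abs_self _).trans hω) hs)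

variable [IsProbabilityMeasure μ]

lemma integrable_exp_sum (h : IsBoundedMartingaleDiff μ 𝓕 Y b v) {s : ℝ} (hs : 0 ≤ s) (n : ℕ) :
    Integrable (fun ω => Real.exp (s * ∑ k ∈ Finset.range n, Y k ω)) μ :=
  Integrable.of_bound ((((h.measurable_sum n).mono (𝓕.le n) le_rfl).const_mul
    s).exp.aestronglyMeasurable) _ (h.abs_exp_sum_le hs n)

/-- Peeling off the last factor: in the quadratic bound on its exponential the linear term averages
to 0 given the past and the square to at most v, so each step costs 1 + κv ≤ exp(κv). -/
lemma integral_exp_sum_le (h : IsBoundedMartingaleDiff μ 𝓕 Y b v) {s : ℝ} (hs : 0 ≤ s)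
    (hb : 0 ≤ b) (hsb : s * b < 1) (n : ℕ) :
    ∫ ω, Real.exp (s * ∑ k ∈ Finset.range n, Y k ω) ∂μ
      ≤ Real.exp (n * (s ^ 2 / (2 * (1 - s * b)) * v)) := by
  set κ := s ^ 2 / (2 * (1 - s * b)) with hκ
  have hκ0 : 0 ≤ κ := div_nonneg (sq_nonneg _) (by linarith)
  induction n with
  | zero => simp
  | succ n ih =>
    set W : Ω → ℝ := fun ω => Real.exp (s * ∑ k ∈ Finset.range n, Y k ω) with hW
    have hWm : Measurable[𝓕 n] W := ((h.measurable_sum n).const_mul s).exp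
    have hWb := h.abs_exp_sum_le hs n
    have hWi : Integrable W μ := h.integrable_exp_sum hs n
    have hYm : Measurable (Y n) := (h.meas n).mono (𝓕.le _) le_rfl
    have hYi : Integrable (Y n) μ := Integrable.of_bound hYm.aestronglyMeasurable b (h.bound n)
    have hY2i : Integrable (fun ω => Y n ω ^ 2) μ := by
      refine Integrable.of_bound (hYm.pow_const 2).aestronglyMeasurable (b ^ 2) ?_
      filter_upwards [h.bound n] with ω hω
      rw [Real.norm_eq_abs, abs_pow]
      exact pow_le_pow_left₀ (abs_nonneg _) hω 2
    have hWm' : AEStronglyMeasurable W μ := (hWm.mono (𝓕.le n) le_rfl).aestronglyMeasurable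
    have hWY : Integrable (fun ω => W ω * Y n ω) μ := hYi.bdd_mul hWm' hWb
    have hWY2 : Integrable (fun ω => W ω * Y n ω ^ 2) μ := hY2i.bdd_mul hWm' hWb
    have e1 : ∫ ω, W ω * Y n ω ∂μ = 0 := by
      rw [integral_mul_eq_integral_mul_condExp (𝓕.le n) hWm hWb hYi]
      rw [integral_congr_ae (g := fun _ => (0 : ℝ))]
      · simp
      · filter_upwards [h.mean n] with ω hω
        simp [hω]
    have e2 : ∫ ω, W ω * Y n ω ^ 2 ∂μ ≤ v * ∫ ω, W ω ∂μ := by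
      rw [integral_mul_eq_integral_mul_condExp (𝓕.le n) hWm hWb hY2i, ← integral_const_mul]
      refine integral_mono_ae (integrable_condExp.bdd_mul hWm' hWb) (hWi.const_mul v) ?_
      filter_upwards [h.var n] with ω hω
      rw [mul_comm v]
      exact mul_le_mul_of_nonneg_left hω (Real.exp_pos _).le
    calc ∫ ω, Real.exp (s * ∑ k ∈ Finset.range (n + 1), Y k ω) ∂μ
        ≤ ∫ ω, (W ω + s * (W ω * Y n ω)) + κ * (W ω * Y n ω ^ 2) ∂μ := by
          refine integral_mono_ae (h.integrable_exp_sum hs (n + 1))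
            ((hWi.add (hWY.const_mul s)).add (hWY2.const_mul κ)) ?_
          filter_upwards [h.bound n] with ω hω
          have h1 : s * Y n ω ≤ s * b := mul_le_mul_of_nonneg_left ((le_abs_self _).trans hω) hs
          have h2 := exp_le_one_add_add_sq (mul_nonneg hs hb) hsb h1
          have h3 : Real.exp (s * ∑ k ∈ Finset.range (n + 1), Y k ω)
              = W ω * Real.exp (s * Y n ω) := by
            rw [Finset.sum_range_succ, mul_add, Real.exp_add]
          rw [h3]
          refine (mul_le_mul_of_nonneg_left h2 (Real.exp_pos _).le).trans (le_of_eq ?_)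
          rw [hκ]; ring
      _ = ∫ ω, W ω ∂μ + s * 0 + κ * ∫ ω, W ω * Y n ω ^ 2 ∂μ := by
          have i1 : Integrable (fun ω => W ω + s * (W ω * Y n ω)) μ := hWi.add (hWY.const_mul s)
          rw [integral_add i1 (hWY2.const_mul κ), integral_add hWi (hWY.const_mul s),
            integral_const_mul, integral_const_mul, e1]
      _ ≤ (1 + κ * v) * ∫ ω, W ω ∂μ := by nlinarith [mul_le_mul_of_nonneg_left e2 hκ0]
      _ ≤ Real.exp (κ * v) * ∫ ω, W ω ∂μ := by
          refine mul_le_mul_of_nonneg_right ?_ (integral_nonneg fun ω => (Real.exp_pos _).le)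
          linarith [Real.add_one_le_exp (κ * v)]
      _ ≤ Real.exp (κ * v) * Real.exp (n * (κ * v)) :=
          mul_le_mul_of_nonneg_left ih (Real.exp_pos _).le
      _ = Real.exp ((n + 1 : ℕ) * (κ * v)) := by
          rw [← Real.exp_add]; push_cast; ring_nf

lemma measureReal_sum_ge_le_exp (h : IsBoundedMartingaleDiff μ 𝓕 Y b v) {s : ℝ} (hs : 0 ≤ s)
    (hb : 0 ≤ b) (hsb : s * b < 1) (n : ℕ) (x : ℝ) :
    μ.real {ω | x ≤ ∑ k ∈ Finset.range n, Y k ω}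
      ≤ Real.exp (n * (s ^ 2 / (2 * (1 - s * b)) * v) - s * x) := by
  have h1 := mul_meas_ge_le_integral_of_nonneg
    (ae_of_all μ fun ω => (Real.exp_pos (s * ∑ k ∈ Finset.range n, Y k ω)).le)
    (h.integrable_exp_sum hs n) (Real.exp (s * x))
  have h2 : μ.real {ω | x ≤ ∑ k ∈ Finset.range n, Y k ω}
      ≤ μ.real {ω | Real.exp (s * x) ≤ Real.exp (s * ∑ k ∈ Finset.range n, Y k ω)} :=
    measureReal_mono fun ω hω => Real.exp_le_exp.2 (mul_le_mul_of_nonneg_left hω hs)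
  have h3 := h.integral_exp_sum_le hs hb hsb n
  rw [Real.exp_sub, le_div_iff₀ (Real.exp_pos _), mul_comm]
  exact (mul_le_mul_of_nonneg_left h2 (Real.exp_pos _).le).trans (h1.trans h3)

/-- **Bernstein's inequality** for martingale differences. -/
theorem measureReal_sum_ge_le (h : IsBoundedMartingaleDiff μ 𝓕 Y b v) (hb : 0 < b) (hv : 0 ≤ v)
    {n : ℕ} (hn : 1 ≤ n) {l : ℝ} (hl : 0 < l) :
    μ.real {ω | Real.sqrt (2 * n * v * l) + 2 * b * l ≤ ∑ k ∈ Finset.range n, Y k ω}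
      ≤ Real.exp (-l) := by
  have hn0 : (0 : ℝ) < n := by exact_mod_cast hn
  rcases hv.eq_or_lt with rfl | hv
  -- Without variance, s = 1/(2b) makes the exponent exactly -l.
  · refine (h.measureReal_sum_ge_le_exp (s := 1 / (2 * b)) (by positivity) hb.le ?_ n _).trans ?_
    · field_simp; norm_num
    · refine Real.exp_le_exp.2 (le_of_eq ?_)
      simp
      field_simp
  · set V := n * v with hV
    have hV0 : 0 < V := mul_pos hn0 hv
    -- a is the optimal slope for a Gaussian tail of variance V. Damping it to s = a / (1 + ba)
    -- ensures sb < 1; then s times the threshold is exactly 2l, while the variance part is l / (1 +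
    -- ba) ≤ l.
    set a := Real.sqrt (2 * l / V) with ha
    have ha0 : 0 < a := Real.sqrt_pos.2 (by positivity)
    have ha2 : a ^ 2 = 2 * l / V := Real.sq_sqrt (by positivity)
    have hl2 : l = a ^ 2 * V / 2 := by rw [ha2]; field_simp
    have hsq : Real.sqrt (2 * n * v * l) = a * V := by
      rw [Real.sqrt_eq_iff_mul_self_eq (by positivity) (by positivity), hl2]
      rw [hV]; ring
    have hd : 0 < 1 + b * a := by positivity
    refine (h.measureReal_sum_ge_le_exp (s := a / (1 + b * a)) (by positivity) hb.le ?_ n _).trans ?_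
    · rw [div_mul_eq_mul_div, div_lt_one hd]; linarith
    · refine Real.exp_le_exp.2 ?_
      have e1 : 1 - a / (1 + b * a) * b = 1 / (1 + b * a) := by field_simp; ring
      rw [e1, hsq]
      have e2 : (n : ℝ) * ((a / (1 + b * a)) ^ 2 / (2 * (1 / (1 + b * a))) * v)
          = l / (1 + b * a) := by
        rw [hl2, hV]; field_simp
      have e3 : a / (1 + b * a) * (a * V + 2 * b * l) = 2 * l * (1 + b * a) / (1 + b * a) := by
        have : a * (a * V) = 2 * l := by rw [hl2]; ring
        rw [div_mul_eq_mul_div, mul_add, this]; ring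
      rw [e2, e3, mul_div_assoc, div_self hd.ne']
      have : l / (1 + b * a) ≤ l := div_le_self hl.le (by nlinarith [mul_pos hb ha0])
      linarith

/-- Two-sided Bernstein inequality for martingale differences. -/
theorem measureReal_abs_sum_ge_le (h : IsBoundedMartingaleDiff μ 𝓕 Y b v) (hb : 0 < b)
    (hv : 0 ≤ v) {n : ℕ} (hn : 1 ≤ n) {l : ℝ} (hl : 0 < l) :
    μ.real {ω | Real.sqrt (2 * n * v * l) + 2 * b * l ≤ |∑ k ∈ Finset.range n, Y k ω|}
      ≤ 2 * Real.exp (-l) := by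
  have h1 := h.measureReal_sum_ge_le hb hv hn hl
  have h2 := h.neg.measureReal_sum_ge_le hb hv hn hl
  have h3 := (measureReal_union_le (μ := μ) _ _).trans (add_le_add h1 h2)
  rw [← two_mul] at h3
  refine (measureReal_mono fun ω hω => ?_).trans h3
  rcases le_abs.1 (Set.mem_ofPred.1 hω) with h | h
  · exact Or.inl h
  · refine Or.inr ?_
    simpa using h

end IsBoundedMartingaleDiff

end Bernstein

/-! ### Moments of the inverse propensity estimates under the exploration distribution. -/

section PlayProb

variable {K : ℕ} {ε : ℝ} {A : Finset (Fin K)} {b : Fin K}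

lemma playProb_of_notMem (hb : b ∈ A) {a : Fin K} (ha : a ∉ A) : playProb ε A b a = 0 := by
  have : a ≠ b := fun h => ha (h ▸ hb)
  simp [playProb, this, ha]

/-- For the greedy action, |A| ≤ K leaves at least 1 - ε + ε/K, and ε ≤ 1. -/
lemma le_playProb (hε : 0 < ε) (hε1 : ε ≤ 1) {a : Fin K} (ha : a ∈ A) :
    ε / K ≤ playProb ε A b a := by
  unfold playProb
  have hK : (0 : ℝ) < K := by exact_mod_cast a.pos
  by_cases h : a = b
  · rw [if_pos h]
    have hA : (A.card : ℝ) ≤ K := by exact_mod_cast (Finset.card_le_univ A).trans (by simp)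
    have : ((A.card : ℝ) - 1) * ε / K ≤ (K - 1) * ε / K := by gcongr
    have h2 : (K - 1) * ε / K + ε / K = ε := by field_simp; ring
    linarith
  · simp [h, ha]

lemma playProb_nonneg (hε : 0 < ε) (hε1 : ε ≤ 1) (hb : b ∈ A) (a : Fin K) :
    0 ≤ playProb ε A b a := by
  by_cases ha : a ∈ A
  · exact (by positivity : 0 ≤ ε / K).trans (le_playProb hε hε1 ha)
  · rw [playProb_of_notMem hb ha]

lemma sum_playProb (hb : b ∈ A) : ∑ a, playProb ε A b a = 1 := by
  have h1 : ∑ a, playProb ε A b a = ∑ a ∈ A, playProb ε A b a :=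
    (Finset.sum_subset (Finset.subset_univ A) fun a _ ha => playProb_of_notMem hb ha).symm
  rw [h1, ← Finset.add_sum_erase A _ hb]
  have h2 : ∑ a ∈ A.erase b, playProb ε A b a = ∑ _a ∈ A.erase b, ε / K := by
    refine Finset.sum_congr rfl fun a ha => ?_
    rw [Finset.mem_erase] at ha
    simp [playProb, ha.1, ha.2]
  rw [h2, Finset.sum_const, Finset.card_erase_of_mem hb, nsmul_eq_mul,
    Nat.cast_sub (Finset.card_pos.2 ⟨b, hb⟩)]
  simp only [playProb, if_true, Nat.cast_one]
  ring

/-- The probability of not following the current policy. -/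
lemma one_sub_playProb_self_le (hε : 0 < ε) (b : Fin K) (hb : b ∈ A) :
    1 - playProb ε A b b ≤ if ∃ a ∈ A, a ≠ b then ε else 0 := by
  have hK : (0 : ℝ) < K := by exact_mod_cast b.pos
  have hA : (A.card : ℝ) ≤ K := by exact_mod_cast (Finset.card_le_univ A).trans (by simp)
  have he : 1 - playProb ε A b b = ((A.card : ℝ) - 1) * ε / K := by simp [playProb]
  rw [he]
  split_ifs with h
  · rw [div_le_iff₀ hK]
    nlinarith
  · push Not at h
    have : A = {b} := Finset.eq_singleton_iff_unique_mem.2 ⟨hb, h⟩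
    simp [this]

/-- The deviation of the inverse propensity estimate of the loss `l` of action `a` when `c` is
played: zero for actions which are not explored. -/
def ipsDev (ε : ℝ) (A : Finset (Fin K)) (b : Fin K) (l : Fin K → ℝ) (c a : Fin K) : ℝ :=
  if a ∈ A then (if a = c then l c / playProb ε A b c else 0) - l a else 0

/-- The inverse propensity estimate on the explored actions. -/
def ipsEst (ε : ℝ) (A : Finset (Fin K)) (b : Fin K) (l : Fin K → ℝ) (c a : Fin K) : ℝ :=
  if a ∈ A ∧ a = c then l c / playProb ε A b c else 0

lemma ipsDev_eq (l : Fin K → ℝ) (c a : Fin K) :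
    ipsDev ε A b l c a = ipsEst ε A b l c a - if a ∈ A then l a else 0 := by
  unfold ipsDev ipsEst
  by_cases h : a ∈ A <;> simp [h]

lemma ipsEst_mem (hε : 0 < ε) (hε1 : ε ≤ 1) {l : Fin K → ℝ} (hl : ∀ a, l a ∈ Set.Icc (0 : ℝ) 1)
    (c a : Fin K) : ipsEst ε A b l c a ∈ Set.Icc 0 (K / ε) := by
  have hK : (0 : ℝ) < K := by exact_mod_cast c.pos
  unfold ipsEst
  split_ifs with h
  · obtain ⟨h1, rfl⟩ := h
    have h2 := le_playProb (b := b) hε hε1 h1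
    have h3 : 0 < ε / K := by positivity
    refine ⟨div_nonneg (hl a).1 (h3.le.trans h2), ?_⟩
    calc l a / playProb ε A b a ≤ 1 / (ε / K) := div_le_div₀ zero_le_one (hl a).2 h3 h2
      _ = K / ε := by rw [one_div_div]
  · exact ⟨le_rfl, by positivity⟩

/-- The estimates lie in [0, K/ε] and the losses in [0, 1]; since both ranges are one-sided, taking
differences of two actions does not double the bound. -/
lemma abs_ipsDev_sub_le (hε : 0 < ε) (hε1 : ε ≤ 1) {l : Fin K → ℝ}
    (hl : ∀ a, l a ∈ Set.Icc (0 : ℝ) 1) (c a a' : Fin K) :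
    |ipsDev ε A b l c a - ipsDev ε A b l c a'| ≤ K / ε + 1 := by
  have hw : ∀ a, (if a ∈ A then l a else 0) ∈ Set.Icc (0 : ℝ) 1 := by
    intro a
    split_ifs
    · exact hl a
    · simp
  rw [ipsDev_eq, ipsDev_eq]
  have h1 := ipsEst_mem (A := A) (b := b) hε hε1 hl c a
  have h2 := ipsEst_mem (A := A) (b := b) hε hε1 hl c a'
  have h3 := hw a
  have h4 := hw a'
  rw [abs_le]
  constructor <;> linarith [h1.1, h1.2, h2.1, h2.2, h3.1, h3.2, h4.1, h4.2]

lemma sum_playProb_mul_ipsEst (hε : 0 < ε) (hε1 : ε ≤ 1) (l : Fin K → ℝ) (a : Fin K) :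
    ∑ c, playProb ε A b c * ipsEst ε A b l c a = if a ∈ A then l a else 0 := by
  have hK : (0 : ℝ) < K := by exact_mod_cast a.pos
  by_cases h : a ∈ A
  · have h2 := (by positivity : 0 < ε / K).trans_le (le_playProb (b := b) hε hε1 h)
    rw [Finset.sum_eq_single a]
    · simp only [ipsEst, h, and_self, if_true]
      field_simp
    · intro c _ hc
      simp [ipsEst, hc.symm]
    · simp
  · simp [ipsEst, h]

lemma sum_playProb_mul_ipsDev_sub (hε : 0 < ε) (hε1 : ε ≤ 1) (hb : b ∈ A) (l : Fin K → ℝ)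
    (a a' : Fin K) :
    ∑ c, playProb ε A b c * (ipsDev ε A b l c a - ipsDev ε A b l c a') = 0 := by
  have key : ∀ a, ∑ c, playProb ε A b c * ipsDev ε A b l c a = 0 := by
    intro a
    simp_rw [ipsDev_eq, mul_sub, Finset.sum_sub_distrib, ← Finset.sum_mul, sum_playProb hb,
      sum_playProb_mul_ipsEst hε hε1, one_mul, sub_self]
  simp_rw [mul_sub, Finset.sum_sub_distrib, key, sub_self]

lemma sum_playProb_mul_ipsEst_sq_le (hε : 0 < ε) (hε1 : ε ≤ 1) {l : Fin K → ℝ}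
    (hl : ∀ a, l a ∈ Set.Icc (0 : ℝ) 1) (a : Fin K) :
    ∑ c, playProb ε A b c * ipsEst ε A b l c a ^ 2 ≤ K / ε := by
  have hK : (0 : ℝ) < K := by exact_mod_cast a.pos
  by_cases h : a ∈ A
  · have h1 := le_playProb (b := b) hε hε1 h
    have h2 := (by positivity : 0 < ε / K).trans_le h1
    rw [Finset.sum_eq_single a]
    · simp only [ipsEst, h, and_self, if_true]
      calc playProb ε A b a * (l a / playProb ε A b a) ^ 2 = l a ^ 2 / playProb ε A b a := by
            field_simp
        _ ≤ 1 / (ε / K) := by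
            refine div_le_div₀ zero_le_one ?_ (by positivity) h1
            exact pow_le_one₀ (hl a).1 (hl a).2
        _ = K / ε := by rw [one_div_div]
    · intro c _ hc
      simp [ipsEst, hc.symm]
    · simp
  · simp only [ipsEst, h, false_and, if_false]
    simp
    positivity

/-- Only the played action has a nonzero estimate, so estimates of distinct actions have product 0
and the second moments, each at most K/ε, simply add; centering only decreases the sum. The
indicator is what later produces the factor ρ. -/
lemma sum_playProb_mul_ipsDev_sub_sq_le (hε : 0 < ε) (hε1 : ε ≤ 1) (hb : b ∈ A) {l : Fin K → ℝ}
    (hl : ∀ a, l a ∈ Set.Icc (0 : ℝ) 1) (a a' : Fin K) :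
    ∑ c, playProb ε A b c * (ipsDev ε A b l c a - ipsDev ε A b l c a') ^ 2
      ≤ 2 * K / ε * if a ≠ a' then 1 else 0 := by
  by_cases h : a = a'
  · simp [h]
  · simp only [ne_eq, h, not_false_eq_true, if_true, mul_one]
    set m : ℝ := (if a ∈ A then l a else 0) - if a' ∈ A then l a' else 0 with hm
    set u := fun c => ipsEst ε A b l c a
    set u' := fun c => ipsEst ε A b l c a'
    have h1 : ∀ c, playProb ε A b c * (ipsDev ε A b l c a - ipsDev ε A b l c a') ^ 2
        = playProb ε A b c * u c ^ 2 + playProb ε A b c * u' c ^ 2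
          - 2 * m * (playProb ε A b c * u c - playProb ε A b c * u' c)
          + playProb ε A b c * m ^ 2 := by
      intro c
      have h0 : u c * u' c = 0 := by
        simp only [u, u', ipsEst]
        by_cases hc : a = c
        · have : a' ≠ c := fun h' => h (hc.trans h'.symm)
          simp [this]
        · simp [hc]
      have : ipsDev ε A b l c a - ipsDev ε A b l c a' = u c - u' c - m := by
        rw [ipsDev_eq, ipsDev_eq, hm]; ring
      rw [this]
      linear_combination (-2 * playProb ε A b c) * h0
    simp_rw [h1]
    rw [Finset.sum_add_distrib, Finset.sum_sub_distrib, Finset.sum_add_distrib, ← Finset.mul_sum,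
      Finset.sum_sub_distrib, ← Finset.sum_mul, sum_playProb hb,
      sum_playProb_mul_ipsEst hε hε1, sum_playProb_mul_ipsEst hε hε1, ← hm]
    have h2 := sum_playProb_mul_ipsEst_sq_le (A := A) (b := b) hε hε1 hl a
    have h3 := sum_playProb_mul_ipsEst_sq_le (A := A) (b := b) hε hε1 hl a'
    have h4 : (2 * K / ε : ℝ) = K / ε + K / ε := by ring
    rw [h4]
    nlinarith [sq_nonneg m]

end PlayProb

/-! ### Empirical losses as sums, and a description of the explored set. -/

section Deterministic

variable {X : Type*} {K : ℕ}

lemma empLoss_map_range (T : ℕ) (f : ℕ → X × (Fin K → ℝ)) (π : X → Fin K) :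
    empLoss ((List.range T).map f) π = (∑ s ∈ Finset.range T, (f s).2 (π (f s).1)) / T := by
  unfold empLoss
  rw [List.map_map, List.length_map, List.length_range, Finset.sum_range]
  congr 1
  rw [← Fin.sum_ofFn]
  congr 1
  apply List.ext_getElem <;> simp

/-- Being close to the empirical minimizer means being close to every policy, and the restricted
minimizer for a is close as soon as any policy choosing a is. This removes both oracles and the
tie-breaking, leaving finitely many inequalities between empirical losses. -/
lemma mem_exploreSet_iff {Pol : Finset (X → Fin K)} {Δ : ℝ} {Z : List (X × (Fin K → ℝ))}
    {πt : X → Fin K} (hπt : IsOracle Pol (fun _ => True) Z πt) {x : X} {a : Fin K} :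
    a ∈ exploreSet Pol Δ Z πt x ↔
      ∃ π ∈ Pol, π x = a ∧ ∀ π' ∈ Pol, empLoss Z π - empLoss Z π' ≤ Δ := by
  classical
  unfold exploreSet
  simp only [Finset.mem_filter, Finset.mem_univ, true_and]
  constructor
  · rintro ⟨π, ⟨h1, h2, -⟩, h4⟩
    exact ⟨π, h1, h2, fun π' hπ' => by linarith [hπt.2.2 π' hπ' trivial]⟩
  · rintro ⟨π, h1, h2, h3⟩
    obtain ⟨π₀, h4, h5⟩ := Finset.exists_min_image (Pol.filter fun π' => π' x = a) (empLoss Z)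
      ⟨π, Finset.mem_filter.2 ⟨h1, h2⟩⟩
    rw [Finset.mem_filter] at h4
    refine ⟨π₀, ⟨h4.1, h4.2, fun π' h6 h7 => h5 π' (Finset.mem_filter.2 ⟨h6, h7⟩)⟩, ?_⟩
    linarith [h5 π (Finset.mem_filter.2 ⟨h1, h2⟩), h3 πt hπt.1]

namespace Transcript

variable (Pol : Finset (X → Fin K)) (ε δ : ℝ) (S : Transcript X K)

/-- The estimated cost vector of round `t ≥ 1`. -/
def hatLoss (t : ℕ) : Fin K → ℝ := hatLossAt Pol ε δ S (hatSample Pol ε δ S (t - 1)) t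

lemma hatSample_eq_map (T : ℕ) : hatSample Pol ε δ S T
    = (List.range T).map fun s => (S.ctx (s + 1), hatLoss Pol ε δ S (s + 1)) := by
  induction T with
  | zero => rfl
  | succ T ih =>
    rw [hatSample, List.range_succ, List.map_append, ← ih]
    rfl

lemma empLoss_hatSample (T : ℕ) (π : X → Fin K) : empLoss (hatSample Pol ε δ S T) π
    = (∑ s ∈ Finset.range T, hatLoss Pol ε δ S (s + 1) (π (S.ctx (s + 1)))) / T := by
  rw [hatSample_eq_map, empLoss_map_range]

lemma empLoss_tildeSample (T : ℕ) (π : X → Fin K) : empLoss (tildeSample Pol ε δ S T) π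
    = (∑ s ∈ Finset.range T, tildeLoss Pol ε δ S (s + 1) (π (S.ctx (s + 1)))) / T := by
  rw [tildeSample, empLoss_map_range]

lemma empLoss_trueSample (T : ℕ) (π : X → Fin K) : empLoss (trueSample S T) π
    = (∑ s ∈ Finset.range T, S.loss (s + 1) (π (S.ctx (s + 1)))) / T := by
  rw [trueSample, empLoss_map_range]

/-- The cost 1 of unexplored actions cancels, so the estimate deviates from the biased loss only on
explored actions, where the propensity is at least ε/K. -/
lemma hatLoss_sub_tildeLoss (t : ℕ) (a : Fin K) :
    hatLoss Pol ε δ S t a - tildeLoss Pol ε δ S t a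
      = ipsDev ε (explored Pol ε δ S t) (S.pol t (S.ctx t)) (S.loss t) (S.act t) a := by
  unfold hatLoss hatLossAt tildeLoss ipsDev explored
  split_ifs <;> simp

end Transcript

end Deterministic

/-! ### Numerical bounds on e_T and on the deviation widths. -/

section Widths

lemma two_mul_div_deltaT (N : ℕ) {δ : ℝ} (hδ : 0 < δ) {T : ℕ} (hT : 1 ≤ T) :
    2 * N / deltaT δ T = 2 * N * (T * (T + 1)) / δ := by
  have hT0 : (0 : ℝ) < T := by exact_mod_cast hT
  unfold deltaT
  field_simp

lemma mul_succ_mul_two_le {N : ℕ} (hN : 1 ≤ N) {δ : ℝ} (hδ : 0 < δ) (hδ1 : δ < 1) {T : ℕ}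
    (hT : 1 ≤ T) : 2 * ((T : ℝ) * (T + 1)) ≤ 2 * N / deltaT δ T := by
  have hT0 : (1 : ℝ) ≤ T := by exact_mod_cast hT
  have hN0 : (1 : ℝ) ≤ N := by exact_mod_cast hN
  rw [two_mul_div_deltaT N hδ hT, le_div_iff₀ hδ]
  have h1 : 0 ≤ (T : ℝ) * (T + 1) := by positivity
  have h2 : δ ≤ N := hδ1.le.trans hN0
  nlinarith [mul_le_mul_of_nonneg_left h2 h1]

lemma eT_eq (N : ℕ) (δ : ℝ) {T : ℕ} : eT N δ T = 2 * Real.log (2 * N / deltaT δ T) / T := rfl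

lemma one_le_log_div_deltaT {N : ℕ} (hN : 1 ≤ N) {δ : ℝ} (hδ : 0 < δ) (hδ1 : δ < 1) {T : ℕ}
    (hT : 1 ≤ T) : 1 ≤ Real.log (2 * N / deltaT δ T) := by
  have hT0 : (1 : ℝ) ≤ T := by exact_mod_cast hT
  have h1 := mul_succ_mul_two_le hN hδ hδ1 hT
  have h2 : (4 : ℝ) ≤ 2 * N / deltaT δ T := by nlinarith
  rw [Real.le_log_iff_exp_le (by linarith)]
  linarith [Real.exp_one_lt_d9]

lemma two_div_le_eT {N : ℕ} (hN : 1 ≤ N) {δ : ℝ} (hδ : 0 < δ) (hδ1 : δ < 1) {T : ℕ}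
    (hT : 1 ≤ T) : 2 / (T : ℝ) ≤ eT N δ T := by
  have h := one_le_log_div_deltaT hN hδ hδ1 hT
  rw [eT_eq]
  gcongr
  linarith

lemma eT_nonneg {N : ℕ} (hN : 1 ≤ N) {δ : ℝ} (hδ : 0 < δ) (hδ1 : δ < 1) (T : ℕ) :
    0 ≤ eT N δ T := by
  rcases Nat.eq_zero_or_pos T with rfl | hT
  · simp [eT]
  · exact (by positivity : (0 : ℝ) ≤ 2 / T).trans (two_div_le_eT hN hδ hδ1 hT)

/-- For very small samples the deviation bounds are trivial. -/
lemma one_le_eT {N : ℕ} (hN : 1 ≤ N) {δ : ℝ} (hδ : 0 < δ) (hδ1 : δ < 1) {T : ℕ}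
    (hT : 1 ≤ T) (hT3 : T ≤ 3) : 1 ≤ eT N δ T := by
  rcases hT3.eq_or_lt with rfl | hT3
  · have h1 := mul_succ_mul_two_le hN hδ hδ1 hT
    have h2 : (24 : ℝ) ≤ 2 * N / deltaT δ 3 := by norm_num at h1 ⊢; exact h1
    have h3 : (2 : ℝ) ≤ Real.log (2 * N / deltaT δ 3) := by
      rw [Real.le_log_iff_exp_le (by linarith)]
      have : Real.exp 2 = Real.exp 1 * Real.exp 1 := by rw [← Real.exp_add]; norm_num
      rw [this]
      nlinarith [Real.exp_one_lt_d9, Real.exp_pos 1]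
    rw [eT_eq]
    push_cast
    linarith
  · refine le_trans ?_ (two_div_le_eT hN hδ hδ1 hT)
    have hT0 : (0 : ℝ) < T := by exact_mod_cast hT
    rw [le_div_iff₀ hT0]
    have : (T : ℝ) ≤ 2 := by exact_mod_cast (by omega : T ≤ 2)
    linarith

/-- For `n < T` the quantity `e_n` is at most of order `log (T N / δ) / n`. -/
lemma eT_le {N : ℕ} (hN : 1 ≤ N) {δ : ℝ} (hδ : 0 < δ) (hδ1 : δ < 1) {n T : ℕ}
    (hn : 1 ≤ n) (hT : n < T) : eT N δ n ≤ 6 * Real.log (T * N / δ) / n := by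
  have hn0 : (1 : ℝ) ≤ n := by exact_mod_cast hn
  have hN0 : (1 : ℝ) ≤ N := by exact_mod_cast hN
  have hT0 : (n : ℝ) + 1 ≤ T := by exact_mod_cast hT
  -- Uses n(n+1) ≤ T², 2 ≤ T, N ≤ N³ and δ³ ≤ δ. The cube turns into a factor 3 in front of the
  -- logarithm, whence the 6.
  have h1 : 2 * N / deltaT δ n ≤ (T * N / δ) ^ 3 := by
    rw [two_mul_div_deltaT N hδ hn, div_pow]
    have hδ3 : δ ^ 3 ≤ δ := by
      calc δ ^ 3 ≤ δ ^ 1 := pow_le_pow_of_le_one hδ.le hδ1.le (by norm_num)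
        _ = δ := pow_one _
    refine div_le_div₀ (by positivity) ?_ (by positivity) hδ3
    have hnT : (n : ℝ) * (n + 1) ≤ T * T := by nlinarith
    have hN3 : (N : ℝ) ≤ N ^ 3 := le_self_pow₀ hN0 (by norm_num)
    calc 2 * (N : ℝ) * (n * (n + 1)) ≤ T * N ^ 3 * (T * T) := by
          gcongr
          linarith
      _ = (T * N : ℝ) ^ 3 := by ring
  have h2 := one_le_log_div_deltaT hN hδ hδ1 hn
  have hpos : 0 < 2 * N / deltaT δ n := by
    have := mul_succ_mul_two_le hN hδ hδ1 hn
    exact lt_of_lt_of_le (by positivity) this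
  have h3 := Real.log_le_log hpos h1
  rw [Real.log_pow] at h3
  rw [eT_eq]
  push_cast at h3
  exact div_le_div_of_nonneg_right (by linarith) (by positivity)

/-- The sum of the two deviation bounds, for a policy at distance `ρ` of the optimal one. -/
def devWidth (K N : ℕ) (ε δ : ℝ) (T : ℕ) (ρ : ℝ) : ℝ :=
  Real.sqrt (2 * K * ρ * eT N δ T / ε) + (K / ε + 1) * eT N δ T
    + (Real.sqrt (ρ * eT N δ T) + 2 * eT N δ T)

/-- The threshold of round n + 1 is the width after n rounds at distance 1, so it dominates the
width of every policy. -/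
lemma threshold_succ (K N : ℕ) {ε : ℝ} (hε : 0 < ε) (δ : ℝ) (n : ℕ) :
    threshold K N ε δ (n + 1) = devWidth K N ε δ n 1 := by
  unfold threshold devWidth
  rw [Nat.add_sub_cancel]
  have h1 : (2 * K * 1 * eT N δ n / ε : ℝ) = 2 * K / ε * eT N δ n := by ring
  rw [h1, Real.sqrt_mul (by positivity)]
  ring_nf

lemma devWidth_mono (K : ℕ) {N : ℕ} (hN : 1 ≤ N) {ε δ : ℝ} (hε : 0 < ε) (hδ : 0 < δ)
    (hδ1 : δ < 1) (n : ℕ) {ρ ρ' : ℝ} (h : ρ ≤ ρ') :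
    devWidth K N ε δ n ρ ≤ devWidth K N ε δ n ρ' := by
  have := eT_nonneg hN hδ hδ1 n
  unfold devWidth
  gcongr

lemma devWidth_nonneg (K : ℕ) {N : ℕ} (hN : 1 ≤ N) {ε δ : ℝ} (hε : 0 < ε) (hδ : 0 < δ)
    (hδ1 : δ < 1) (n : ℕ) (ρ : ℝ) : 0 ≤ devWidth K N ε δ n ρ := by
  have := eT_nonneg hN hδ hδ1 n
  unfold devWidth
  positivity

/-- Since K/ε ≥ 1, the estimation error dominates the sampling error: 3/2 + 1 ≤ 3 in front of the
root and 1 + 1 + 2 = 4 in front of q = K e_n / ε. -/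
lemma devWidth_le {K N : ℕ} (hK : 1 ≤ K) (hN : 1 ≤ N) {ε δ : ℝ} (hε : 0 < ε) (hε1 : ε ≤ 1)
    (hδ : 0 < δ) (hδ1 : δ < 1) (n : ℕ) {ρ : ℝ} (hρ : 0 ≤ ρ) :
    devWidth K N ε δ n ρ
      ≤ 3 * Real.sqrt (ρ * (K * eT N δ n / ε)) + 4 * (K * eT N δ n / ε) := by
  have he := eT_nonneg hN hδ hδ1 n
  have hK0 : (1 : ℝ) ≤ K := by exact_mod_cast hK
  have hκ : 1 ≤ (K : ℝ) / ε := by rw [le_div_iff₀ hε]; linarith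
  unfold devWidth
  set e := eT N δ n
  have hq : (K : ℝ) * e / ε = K / ε * e := by ring
  rw [hq]
  set κ : ℝ := K / ε
  have h1 : Real.sqrt (2 * K * ρ * e / ε) ≤ 3 / 2 * Real.sqrt (ρ * (κ * e)) := by
    have : (2 * K * ρ * e / ε : ℝ) = 2 * (ρ * (κ * e)) := by simp only [κ]; ring
    rw [this, Real.sqrt_mul (by norm_num)]
    have : Real.sqrt 2 ≤ 3 / 2 := by
      rw [Real.sqrt_le_left (by norm_num)]; norm_num
    gcongr
  have h2 : Real.sqrt (ρ * e) ≤ Real.sqrt (ρ * (κ * e)) := by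
    apply Real.sqrt_le_sqrt
    gcongr
    nlinarith
  have h3 : e ≤ κ * e := by nlinarith
  nlinarith [Real.sqrt_nonneg (ρ * (κ * e))]

/-- Solving the self-bounding inequality that the Massart condition yields. -/
lemma le_of_le_sqrt_add {x ρ q τ : ℝ} (hρ : 0 ≤ ρ) (hq : 0 ≤ q) (hτ : 0 < τ) (hτ1 : τ ≤ 1)
    (hx : x ≤ 3 * Real.sqrt (ρ * q) + 4 * q) (hm : ρ ≤ 1 / τ * x) : x ≤ 17 / τ * q := by
  -- AM-GM with weights chosen so that Massart bounds τρ by x: half of x is absorbed on the left,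
  -- and 9 + 8 = 17 remains.
  have h1 : 3 * Real.sqrt (ρ * q) ≤ (τ * ρ + 9 * q / τ) / 2 := by
    have e1 : 3 * Real.sqrt (ρ * q) = Real.sqrt (τ * ρ) * Real.sqrt (9 * q / τ) := by
      rw [← Real.sqrt_mul (by positivity)]
      have : τ * ρ * (9 * q / τ) = 3 ^ 2 * (ρ * q) := by field_simp; ring
      rw [this, Real.sqrt_mul (by positivity) (ρ * q), Real.sqrt_sq (by norm_num)]
    have e2 := Real.sq_sqrt (show 0 ≤ τ * ρ by positivity)
    have e3 := Real.sq_sqrt (show 0 ≤ 9 * q / τ by positivity)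
    rw [e1]
    nlinarith [sq_nonneg (Real.sqrt (τ * ρ) - Real.sqrt (9 * q / τ))]
  have h2 : τ * ρ ≤ x := by
    calc τ * ρ ≤ τ * (1 / τ * x) := mul_le_mul_of_nonneg_left hm hτ.le
      _ = x := by field_simp
  have h3 : q ≤ q / τ := by
    rw [le_div_iff₀ hτ]; nlinarith
  have h4 : 9 * q / τ = 9 * (q / τ) := by ring
  have h5 : 17 / τ * q = 17 * (q / τ) := by ring
  rw [h5]
  rw [h4] at h1
  linarith

end Widths

/-! ### Consequences of the deviation bounds along a single transcript. -/

section Good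

variable {X : Type*} [MeasurableSpace X] {K : ℕ}

namespace Problem

variable (B : Problem X K)

instance : IsProbabilityMeasure B.D := B.isProb

instance : IsProbabilityMeasure B.ctxLaw :=
  Measure.isProbabilityMeasure_map measurable_fst.aemeasurable

lemma one_le_K (B : Problem X K) : 1 ≤ K := by
  obtain ⟨z⟩ := nonempty_of_isProbabilityMeasure B.D
  exact (B.opt z.1).pos

lemma one_le_card : 1 ≤ B.Pol.card := Finset.card_pos.2 ⟨_, B.opt_mem⟩

lemma rho_nonneg (π π' : X → Fin K) : 0 ≤ B.rho π π' := measureReal_nonneg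

lemma rho_le_one (π π' : X → Fin K) : B.rho π π' ≤ 1 := measureReal_le_one

lemma risk_opt_le {π : X → Fin K} (hπ : π ∈ B.Pol) : B.risk B.opt ≤ B.risk π := B.opt_min π hπ

end Problem

/-- The deviation bounds hold at time `T`. -/
def DevBound (B : Problem X K) (ε δ : ℝ) (S : Transcript X K) (T : ℕ) : Prop :=
  ∀ π ∈ B.Pol,
    |(empLoss (Transcript.hatSample B.Pol ε δ S T) π
        - empLoss (Transcript.hatSample B.Pol ε δ S T) B.opt)
      - (empLoss (Transcript.tildeSample B.Pol ε δ S T) π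
        - empLoss (Transcript.tildeSample B.Pol ε δ S T) B.opt)|
      ≤ Real.sqrt (2 * K * B.rho π B.opt * eT B.Pol.card δ T / ε)
        + (K / ε + 1) * eT B.Pol.card δ T ∧
    |(empLoss (S.trueSample T) π - empLoss (S.trueSample T) B.opt)
      - (B.risk π - B.risk B.opt)|
      ≤ Real.sqrt (B.rho π B.opt * eT B.Pol.card δ T) + 2 * eT B.Pol.card δ T

lemma goodEvent_eq {Ω : Type*} [MeasurableSpace Ω] (B : Problem X K) (ε δ : ℝ)
    (S : Ω → Transcript X K) :
    goodEvent B ε δ S = {ω | ∀ T, 1 ≤ T → DevBound B ε δ (S ω) T} := by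
  ext ω
  exact ⟨fun h T hT π hπ => h π hπ T hT, fun h π hπ T hT => h T hT π hπ⟩

lemma mem_explored_iff {B : Problem X K} {ε δ : ℝ} {S : Transcript X K} {n : ℕ}
    (h : IsOracle B.Pol (fun _ => True) (Transcript.hatSample B.Pol ε δ S n) (S.pol (n + 1)))
    {a : Fin K} :
    a ∈ S.explored B.Pol ε δ (n + 1) ↔ ∃ π ∈ B.Pol, π (S.ctx (n + 1)) = a ∧ ∀ π' ∈ B.Pol,
      empLoss (S.hatSample B.Pol ε δ n) π - empLoss (S.hatSample B.Pol ε δ n) π'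
        ≤ threshold K B.Pol.card ε δ (n + 1) :=
  mem_exploreSet_iff h

section

variable {B : Problem X K} {ε δ : ℝ} {S : Transcript X K}

lemma pol_mem_explored (hε : 0 < ε) (hδ : 0 < δ) (hδ1 : δ < 1) {n : ℕ}
    (h : IsOracle B.Pol (fun _ => True) (Transcript.hatSample B.Pol ε δ S n) (S.pol (n + 1))) :
    S.pol (n + 1) (S.ctx (n + 1)) ∈ S.explored B.Pol ε δ (n + 1) := by
  rw [mem_explored_iff h]
  refine ⟨_, h.1, rfl, fun π' hπ' => ?_⟩
  rw [threshold_succ _ _ hε]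
  linarith [h.2.2 π' hπ' trivial, devWidth_nonneg K B.one_le_card hε hδ hδ1 n 1]

/-- Replacing losses by 1 raises those of π and leaves those of the optimal policy intact, because
its actions are explored. This is why the bias never needs a bound of its own. -/
lemma trueDiff_le_tildeDiff (hloss : ∀ t a, S.loss (t + 1) a ∈ Set.Icc (0 : ℝ) 1) {n : ℕ}
    (hopt : ∀ s < n, B.opt (S.ctx (s + 1)) ∈ S.explored B.Pol ε δ (s + 1)) (π : X → Fin K) :
    empLoss (S.trueSample n) π - empLoss (S.trueSample n) B.opt
      ≤ empLoss (S.tildeSample B.Pol ε δ n) π - empLoss (S.tildeSample B.Pol ε δ n) B.opt := by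
  rw [Transcript.empLoss_trueSample, Transcript.empLoss_trueSample,
    Transcript.empLoss_tildeSample, Transcript.empLoss_tildeSample, ← sub_div, ← sub_div,
    ← Finset.sum_sub_distrib, ← Finset.sum_sub_distrib]
  gcongr with s hs
  · unfold Transcript.tildeLoss
    split_ifs
    · exact le_rfl
    · exact (hloss _ _).2
  · unfold Transcript.tildeLoss
    rw [if_pos (hopt s (Finset.mem_range.1 hs))]

/-- As long as the optimal action has always been explored, the excess risk is controlled by the
excess empirical loss. -/
lemma risk_sub_le (hloss : ∀ t a, S.loss (t + 1) a ∈ Set.Icc (0 : ℝ) 1) {n : ℕ}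
    (hopt : ∀ s < n, B.opt (S.ctx (s + 1)) ∈ S.explored B.Pol ε δ (s + 1))
    (hdev : DevBound B ε δ S n) {π : X → Fin K} (hπ : π ∈ B.Pol) :
    B.risk π - B.risk B.opt ≤ empLoss (S.hatSample B.Pol ε δ n) π
      - empLoss (S.hatSample B.Pol ε δ n) B.opt
      + devWidth K B.Pol.card ε δ n (B.rho π B.opt) := by
  obtain ⟨h1, h2⟩ := hdev π hπ
  have h3 := trueDiff_le_tildeDiff hloss hopt π
  have h4 := (abs_le.1 h1).1
  have h5 := (abs_le.1 h2).1
  unfold devWidth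
  linarith

/-- The action of the optimal policy is never eliminated on the good event. -/
lemma opt_mem_explored (hε : 0 < ε) (hδ : 0 < δ) (hδ1 : δ < 1)
    (h : ∀ t, IsOracle B.Pol (fun _ => True) (S.hatSample B.Pol ε δ t) (S.pol (t + 1)))
    (hloss : ∀ t a, S.loss (t + 1) a ∈ Set.Icc (0 : ℝ) 1) {n : ℕ}
    (hdev : ∀ T, 1 ≤ T → T ≤ n → DevBound B ε δ S T) :
    ∀ m ≤ n, B.opt (S.ctx (m + 1)) ∈ S.explored B.Pol ε δ (m + 1) := by
  intro m
  induction m using Nat.strong_induction_on with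
  | _ m ih =>
    intro hm
    rw [mem_explored_iff (h m)]
    refine ⟨_, B.opt_mem, rfl, fun π' hπ' => ?_⟩
    rw [threshold_succ _ _ hε]
    -- In the first round the sample is empty and all empirical losses are 0.
    rcases Nat.eq_zero_or_pos m with rfl | hm0
    · have := devWidth_nonneg K B.one_le_card hε hδ hδ1 0 1
      simpa [Transcript.hatSample, empLoss] using this
    · have h1 := risk_sub_le hloss (fun s hs => ih s hs (by omega)) (hdev m hm0 hm) hπ'
      have h2 := devWidth_mono K B.one_le_card hε hδ hδ1 m (B.rho_le_one π' B.opt)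
      linarith [B.risk_opt_le hπ']

/-- The excess risk of the current policy on the good event. -/
lemma risk_pol_sub_le (hε : 0 < ε) (hε1 : ε ≤ 1) (hδ : 0 < δ) (hδ1 : δ < 1)
    {τ : ℝ} (hτ : B.Massart τ) (hτ1 : τ ≤ 1)
    (h : ∀ t, IsOracle B.Pol (fun _ => True) (S.hatSample B.Pol ε δ t) (S.pol (t + 1)))
    (hloss : ∀ t a, S.loss (t + 1) a ∈ Set.Icc (0 : ℝ) 1) {n : ℕ} (hn : 1 ≤ n)
    (hdev : ∀ T, 1 ≤ T → T ≤ n → DevBound B ε δ S T) :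
    B.risk (S.pol (n + 1)) - B.risk B.opt ≤ 17 / τ * (K * eT B.Pol.card δ n / ε) := by
  have hopt := opt_mem_explored hε hδ hδ1 h hloss hdev
  have h1 := risk_sub_le hloss (fun s hs => hopt s (by omega)) (hdev n hn le_rfl) (h n).1
  -- The current policy is at least as good empirically as the optimal one, so its excess risk is at
  -- most the width at its own distance.
  have h2 := (h n).2.2 _ B.opt_mem trivial
  have h3 := devWidth_le B.one_le_K B.one_le_card hε hε1 hδ hδ1 n
    (B.rho_nonneg (S.pol (n + 1)) B.opt)
  have he := eT_nonneg B.one_le_card hδ hδ1 n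
  exact le_of_le_sqrt_add (B.rho_nonneg _ _) (by positivity) hτ.1 hτ1 (by linarith)
    (hτ.2 _ (h n).1)

/-- A round with a real choice has its context in a small disagreement region. -/
lemma ctx_mem_disRegion (hε : 0 < ε) (hε1 : ε ≤ 1) (hδ : 0 < δ) (hδ1 : δ < 1)
    {τ : ℝ} (hτ : B.Massart τ)
    (h : ∀ t, IsOracle B.Pol (fun _ => True) (S.hatSample B.Pol ε δ t) (S.pol (t + 1)))
    (hloss : ∀ t a, S.loss (t + 1) a ∈ Set.Icc (0 : ℝ) 1) {n : ℕ} (hn : 1 ≤ n)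
    (hdev : ∀ T, 1 ≤ T → T ≤ n → DevBound B ε δ S T)
    (hq : K * eT B.Pol.card δ n / ε ≤ 1)
    (ha : ∃ a ∈ S.explored B.Pol ε δ (n + 1), a ≠ S.pol (n + 1) (S.ctx (n + 1))) :
    S.ctx (n + 1) ∈ B.disRegion (14 / τ * Real.sqrt (K * eT B.Pol.card δ n / ε)) := by
  have hopt := opt_mem_explored hε hδ hδ1 h hloss hdev
  have he := eT_nonneg B.one_le_card hδ hδ1 n
  -- The policy witnessing a has an estimated gap of at most the threshold, so its excess risk is at
  -- most twice the width at distance 1, that is 2 (3√q + 4q) ≤ 14√q for q ≤ 1.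
  have key : ∀ a ∈ S.explored B.Pol ε δ (n + 1), a ≠ B.opt (S.ctx (n + 1)) →
      S.ctx (n + 1) ∈ B.disRegion (14 / τ * Real.sqrt (K * eT B.Pol.card δ n / ε)) := by
    intro a ha hne
    obtain ⟨π, hπ, hπa, hπ'⟩ := (mem_explored_iff (h n)).1 ha
    refine ⟨π, hπ, ?_, by rwa [hπa]⟩
    have h1 := risk_sub_le hloss (fun s hs => hopt s (by omega)) (hdev n hn le_rfl) hπ
    have h2 := hπ' _ B.opt_mem
    rw [threshold_succ _ _ hε] at h2
    have h3 := devWidth_mono K B.one_le_card hε hδ hδ1 n (B.rho_le_one π B.opt)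
    have h4 := devWidth_le B.one_le_K B.one_le_card hε hε1 hδ hδ1 n zero_le_one
    rw [one_mul] at h4
    set q : ℝ := K * eT B.Pol.card δ n / ε
    have hq0 : 0 ≤ q := by positivity
    have h5 : q ≤ Real.sqrt q := by
      apply Real.le_sqrt_of_sq_le
      nlinarith
    refine (hτ.2 π hπ).trans ?_
    have hτ0 := hτ.1
    calc 1 / τ * (B.risk π - B.risk B.opt) ≤ 1 / τ * (14 * Real.sqrt q) := by
          gcongr
          linarith
      _ = 14 / τ * Real.sqrt q := by ring
  obtain ⟨a, ha, hne⟩ := ha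
  -- Of the two distinct explored actions, at least one is not the optimal policy's.
  by_cases hao : a = B.opt (S.ctx (n + 1))
  · exact key _ (pol_mem_explored hε hδ hδ1 (h n)) (by rw [← hao]; exact hne.symm)
  · exact key a ha hao

end

end Good

/-! ### Measurability of quantities indexed by random actions. -/

section Measurability

variable {Ω : Type*} {m : MeasurableSpace Ω} {K : ℕ}

lemma measurable_apply_fin {f : Fin K → Ω → ℝ} {g : Ω → Fin K} (hf : ∀ a, Measurable[m] (f a))
    (hg : Measurable[m] g) : Measurable[m] fun ω => f (g ω) ω := by
  have : (fun ω => f (g ω) ω) = fun ω => ∑ a, if g ω = a then f a ω else 0 := by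
    ext ω; simp
  rw [this]
  exact Finset.measurable_sum _ fun a _ =>
    Measurable.ite (hg (measurableSet_singleton a)) (hf a) measurable_const

variable {A : Ω → Finset (Fin K)} {b : Ω → Fin K} {l : Ω → Fin K → ℝ}

lemma measurable_card_finset (hA : ∀ a, MeasurableSet[m] {ω | a ∈ A ω}) :
    Measurable[m] fun ω => ((A ω).card : ℝ) := by
  have : (fun ω => ((A ω).card : ℝ)) = fun ω => ∑ a, if a ∈ A ω then (1 : ℝ) else 0 := by
    ext ω; simp
  rw [this]
  exact Finset.measurable_sum _ fun a _ => Measurable.ite (hA a) measurable_const measurable_const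

lemma measurable_playProb (ε : ℝ) (hA : ∀ a, MeasurableSet[m] {ω | a ∈ A ω})
    (hb : Measurable[m] b) (c : Fin K) : Measurable[m] fun ω => playProb ε (A ω) (b ω) c := by
  unfold playProb
  have hs : MeasurableSet[m] {ω | c = b ω} := by
    have := hb (measurableSet_singleton c)
    convert this using 1
    ext ω
    exact eq_comm
  refine Measurable.ite hs ?_ (Measurable.ite (hA c) measurable_const measurable_const)
  exact measurable_const.sub ((((measurable_card_finset hA).sub_const 1).mul_const ε).div_const _)

lemma measurable_ipsDev (ε : ℝ) (hA : ∀ a, MeasurableSet[m] {ω | a ∈ A ω})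
    (hb : Measurable[m] b) (hl : ∀ a, Measurable[m] fun ω => l ω a) (c a : Fin K) :
    Measurable[m] fun ω => ipsDev ε (A ω) (b ω) (l ω) c a := by
  unfold ipsDev
  refine Measurable.ite (hA a) (Measurable.sub ?_ (hl a)) measurable_const
  by_cases h : a = c
  · simp only [h, if_true]
    exact (hl c).div (measurable_playProb ε hA hb c)
  · simp only [h, if_false]
    exact measurable_const

end Measurability

/-! ### Adaptedness of the samples, the explored sets and the deviation bounds. -/

section Run

variable {X : Type*} [MeasurableSpace X] {K : ℕ} {Ω : Type*} [mΩ : MeasurableSpace Ω]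
  {B : Problem X K} {ε δ : ℝ} {μ : Measure Ω} {𝓕 : Filtration ℕ mΩ} {S : Ω → Transcript X K}

/-- The context and the loss vector of round `n + 1`. -/
def sample (S : Ω → Transcript X K) (n : ℕ) (ω : Ω) : X × (Fin K → ℝ) :=
  ((S ω).ctx (n + 1), (S ω).loss (n + 1))

/-- The information before the action of round `n + 1` is drawn, including the losses. -/
abbrev preAct (𝓕 : Filtration ℕ mΩ) (S : Ω → Transcript X K) (n : ℕ) : MeasurableSpace Ω :=
  𝓕 n ⊔ MeasurableSpace.comap (sample S n) inferInstance

lemma le_preAct (𝓕 : Filtration ℕ mΩ) (S : Ω → Transcript X K) (n : ℕ) : 𝓕 n ≤ preAct 𝓕 S n :=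
  le_sup_left

namespace IsRun

lemma measurable_sample_succ (h : IsRun B ε δ μ 𝓕 S) (n : ℕ) :
    Measurable[𝓕 (n + 1)] (sample S n) :=
  (h.ctx_meas n).prodMk (h.loss_meas n)

lemma measurable_sample (h : IsRun B ε δ μ 𝓕 S) (n : ℕ) : Measurable (sample S n) :=
  (h.measurable_sample_succ n).mono (𝓕.le _) le_rfl

lemma preAct_le_succ (h : IsRun B ε δ μ 𝓕 S) (n : ℕ) : preAct 𝓕 S n ≤ 𝓕 (n + 1) :=
  sup_le (𝓕.mono n.le_succ) (h.measurable_sample_succ n).comap_le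

lemma preAct_le (h : IsRun B ε δ μ 𝓕 S) (n : ℕ) : preAct 𝓕 S n ≤ mΩ :=
  (h.preAct_le_succ n).trans (𝓕.le _)

lemma measurable_sample_preAct (_h : IsRun B ε δ μ 𝓕 S) (n : ℕ) :
    Measurable[preAct 𝓕 S n] (sample S n) :=
  (comap_measurable (sample S n)).mono le_sup_right le_rfl

lemma measurable_ctx (h : IsRun B ε δ μ 𝓕 S) (n : ℕ) :
    Measurable[preAct 𝓕 S n] fun ω => (S ω).ctx (n + 1) :=
  measurable_fst.comp (h.measurable_sample_preAct n)

lemma measurable_loss (h : IsRun B ε δ μ 𝓕 S) (n : ℕ) (a : Fin K) :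
    Measurable[preAct 𝓕 S n] fun ω => (S ω).loss (n + 1) a :=
  (measurable_pi_apply a).comp (measurable_snd.comp (h.measurable_sample_preAct n))

lemma measurable_pol_apply (h : IsRun B ε δ μ 𝓕 S) (n : ℕ) {π : X → Fin K} (hπ : π ∈ B.Pol) :
    Measurable[preAct 𝓕 S n] fun ω => π ((S ω).ctx (n + 1)) :=
  (B.measurable_pol π hπ).comp (h.measurable_ctx n)

lemma measurableSet_pol_eq (h : IsRun B ε δ μ 𝓕 S) (n : ℕ) {π : X → Fin K} (hπ : π ∈ B.Pol) :
    MeasurableSet[preAct 𝓕 S n] {ω | (S ω).pol (n + 1) = π} :=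
  le_preAct 𝓕 S n _ (h.pol_meas n π hπ)

/-- The policy takes values in a finite class, so the event splits over the constant policies, and
no σ-algebra on functions is involved. -/
lemma measurable_greedy (h : IsRun B ε δ μ 𝓕 S) (n : ℕ) :
    Measurable[preAct 𝓕 S n] fun ω => (S ω).pol (n + 1) ((S ω).ctx (n + 1)) := by
  refine @measurable_to_countable' _ _ _ _ (preAct 𝓕 S n) _ fun a => ?_
  have : (fun ω => (S ω).pol (n + 1) ((S ω).ctx (n + 1))) ⁻¹' {a}
      = ⋃ π ∈ B.Pol, {ω | (S ω).pol (n + 1) = π} ∩ (fun ω => π ((S ω).ctx (n + 1))) ⁻¹' {a} := by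
    ext ω
    simp only [Set.mem_preimage, Set.mem_singleton_iff, Set.mem_iUnion, Set.mem_inter_iff,
      Set.mem_ofPred_eq, exists_prop]
    constructor
    · intro ha
      exact ⟨_, (h.pol_oracle n ω).1, rfl, ha⟩
    · rintro ⟨π, -, rfl, ha⟩
      exact ha
  rw [this]
  exact Finset.measurableSet_biUnion _ fun π hπ =>
    (h.measurableSet_pol_eq n hπ).inter (h.measurable_pol_apply n hπ (measurableSet_singleton a))

/-- The sample determines the explored set, which determines the next sample. The versions that
assume measurability of the current sample break this circle and feed the strong induction in
`measurable_empLoss_hatSample`. -/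
lemma measurableSet_mem_explored_of (h : IsRun B ε δ μ 𝓕 S) {n : ℕ}
    (hH : ∀ π ∈ B.Pol, Measurable[𝓕 n] fun ω => empLoss ((S ω).hatSample B.Pol ε δ n) π)
    (a : Fin K) : MeasurableSet[preAct 𝓕 S n] {ω | a ∈ (S ω).explored B.Pol ε δ (n + 1)} := by
  have : {ω | a ∈ (S ω).explored B.Pol ε δ (n + 1)}
      = ⋃ π ∈ B.Pol, (fun ω => π ((S ω).ctx (n + 1))) ⁻¹' {a} ∩ ⋂ π' ∈ B.Pol,
        {ω | empLoss ((S ω).hatSample B.Pol ε δ n) π - empLoss ((S ω).hatSample B.Pol ε δ n) π'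
          ≤ threshold K B.Pol.card ε δ (n + 1)} := by
    ext ω
    simp only [Set.mem_ofPred_eq, mem_explored_iff (h.pol_oracle n ω), Set.mem_iUnion,
      Set.mem_inter_iff, Set.mem_preimage, Set.mem_singleton_iff, Set.mem_iInter, exists_prop]
  rw [this]
  refine Finset.measurableSet_biUnion _ fun π hπ =>
    (h.measurable_pol_apply n hπ (measurableSet_singleton a)).inter
      (Finset.measurableSet_biInter _ fun π' hπ' => le_preAct 𝓕 S n _ ?_)
  exact measurableSet_le ((hH π hπ).sub (hH π' hπ')) measurable_const

lemma measurable_tildeLoss_of (h : IsRun B ε δ μ 𝓕 S) {n : ℕ}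
    (hA : ∀ a, MeasurableSet[preAct 𝓕 S n] {ω | a ∈ (S ω).explored B.Pol ε δ (n + 1)})
    {π : X → Fin K} (hπ : π ∈ B.Pol) : Measurable[preAct 𝓕 S n]
      fun ω => (S ω).tildeLoss B.Pol ε δ (n + 1) (π ((S ω).ctx (n + 1))) := by
  refine measurable_apply_fin (f := fun a ω => (S ω).tildeLoss B.Pol ε δ (n + 1) a)
    (fun a => ?_) (h.measurable_pol_apply n hπ)
  unfold Transcript.tildeLoss
  exact Measurable.ite (hA a) (h.measurable_loss n a) measurable_const

lemma measurable_ipsDev_of (h : IsRun B ε δ μ 𝓕 S) {n : ℕ}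
    (hA : ∀ a, MeasurableSet[preAct 𝓕 S n] {ω | a ∈ (S ω).explored B.Pol ε δ (n + 1)})
    {π : X → Fin K} (hπ : π ∈ B.Pol) (c : Fin K) : Measurable[preAct 𝓕 S n]
      fun ω => ipsDev ε ((S ω).explored B.Pol ε δ (n + 1)) ((S ω).pol (n + 1) ((S ω).ctx (n + 1)))
        ((S ω).loss (n + 1)) c (π ((S ω).ctx (n + 1))) :=
  measurable_apply_fin (f := fun a ω => ipsDev ε ((S ω).explored B.Pol ε δ (n + 1))
      ((S ω).pol (n + 1) ((S ω).ctx (n + 1))) ((S ω).loss (n + 1)) c a)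
    (fun a => measurable_ipsDev ε hA (h.measurable_greedy n) (h.measurable_loss n) c a)
    (h.measurable_pol_apply n hπ)

lemma measurable_hatLoss_of (h : IsRun B ε δ μ 𝓕 S) {n : ℕ}
    (hA : ∀ a, MeasurableSet[preAct 𝓕 S n] {ω | a ∈ (S ω).explored B.Pol ε δ (n + 1)})
    {π : X → Fin K} (hπ : π ∈ B.Pol) : Measurable[𝓕 (n + 1)]
      fun ω => (S ω).hatLoss B.Pol ε δ (n + 1) (π ((S ω).ctx (n + 1))) := by
  have h1 := (h.measurable_tildeLoss_of hA hπ).mono (h.preAct_le_succ n) le_rfl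
  have h2 := measurable_apply_fin
    (fun c => (h.measurable_ipsDev_of hA hπ c).mono (h.preAct_le_succ n) le_rfl) (h.act_meas n)
  convert h2.add h1 using 1
  ext ω
  simp [← Transcript.hatLoss_sub_tildeLoss]

lemma measurable_empLoss_hatSample (h : IsRun B ε δ μ 𝓕 S) (n : ℕ) {π : X → Fin K}
    (hπ : π ∈ B.Pol) : Measurable[𝓕 n] fun ω => empLoss ((S ω).hatSample B.Pol ε δ n) π := by
  induction n using Nat.strong_induction_on generalizing π with
  | _ n ih =>
    simp_rw [Transcript.empLoss_hatSample]
    refine (Finset.measurable_sum _ fun s hs => ?_).div_const _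
    have hs' := Finset.mem_range.1 hs
    exact (h.measurable_hatLoss_of (h.measurableSet_mem_explored_of fun π hπ => ih s hs' hπ)
      hπ).mono (𝓕.mono hs') le_rfl

lemma measurableSet_mem_explored (h : IsRun B ε δ μ 𝓕 S) (n : ℕ) (a : Fin K) :
    MeasurableSet[preAct 𝓕 S n] {ω | a ∈ (S ω).explored B.Pol ε δ (n + 1)} :=
  h.measurableSet_mem_explored_of (fun _ hπ => h.measurable_empLoss_hatSample n hπ) a

lemma measurable_empLoss_tildeSample (h : IsRun B ε δ μ 𝓕 S) (n : ℕ) {π : X → Fin K}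
    (hπ : π ∈ B.Pol) : Measurable[𝓕 n] fun ω => empLoss ((S ω).tildeSample B.Pol ε δ n) π := by
  simp_rw [Transcript.empLoss_tildeSample]
  refine (Finset.measurable_sum _ fun s hs => ?_).div_const _
  exact (h.measurable_tildeLoss_of (h.measurableSet_mem_explored s) hπ).mono
    ((h.preAct_le_succ s).trans (𝓕.mono (Finset.mem_range.1 hs))) le_rfl

lemma measurable_loss_pol (h : IsRun B ε δ μ 𝓕 S) (n : ℕ) {π : X → Fin K} (hπ : π ∈ B.Pol) :
    Measurable[preAct 𝓕 S n] fun ω => (S ω).loss (n + 1) (π ((S ω).ctx (n + 1))) :=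
  measurable_apply_fin (f := fun a ω => (S ω).loss (n + 1) a) (h.measurable_loss n)
    (h.measurable_pol_apply n hπ)

lemma measurable_empLoss_trueSample (h : IsRun B ε δ μ 𝓕 S) (n : ℕ) {π : X → Fin K}
    (hπ : π ∈ B.Pol) : Measurable[𝓕 n] fun ω => empLoss ((S ω).trueSample n) π := by
  simp_rw [Transcript.empLoss_trueSample]
  refine (Finset.measurable_sum _ fun s hs => ?_).div_const _
  exact (h.measurable_loss_pol s hπ).mono
    ((h.preAct_le_succ s).trans (𝓕.mono (Finset.mem_range.1 hs))) le_rfl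

lemma measurableSet_devBound (h : IsRun B ε δ μ 𝓕 S) (n : ℕ) :
    MeasurableSet[𝓕 n] {ω | DevBound B ε δ (S ω) n} := by
  have : {ω | DevBound B ε δ (S ω) n} = ⋂ π ∈ B.Pol,
    ({ω | |(empLoss ((S ω).hatSample B.Pol ε δ n) π
        - empLoss ((S ω).hatSample B.Pol ε δ n) B.opt)
      - (empLoss ((S ω).tildeSample B.Pol ε δ n) π
        - empLoss ((S ω).tildeSample B.Pol ε δ n) B.opt)|
      ≤ Real.sqrt (2 * K * B.rho π B.opt * eT B.Pol.card δ n / ε)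
        + (K / ε + 1) * eT B.Pol.card δ n} ∩
    {ω | |(empLoss ((S ω).trueSample n) π - empLoss ((S ω).trueSample n) B.opt)
      - (B.risk π - B.risk B.opt)|
      ≤ Real.sqrt (B.rho π B.opt * eT B.Pol.card δ n) + 2 * eT B.Pol.card δ n}) := by
    ext ω
    simp only [DevBound, Set.mem_ofPred_eq, Set.mem_iInter, Set.mem_inter_iff]
  rw [this]
  refine Finset.measurableSet_biInter _ fun π hπ => MeasurableSet.inter ?_ ?_
  · refine measurableSet_le (continuous_abs.measurable.comp ?_) measurable_const
    exact (((h.measurable_empLoss_hatSample n hπ).sub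
      (h.measurable_empLoss_hatSample n B.opt_mem)).sub
        ((h.measurable_empLoss_tildeSample n hπ).sub
          (h.measurable_empLoss_tildeSample n B.opt_mem)))
  · refine measurableSet_le (continuous_abs.measurable.comp ?_) measurable_const
    exact ((h.measurable_empLoss_trueSample n hπ).sub
      (h.measurable_empLoss_trueSample n B.opt_mem)).sub measurable_const

lemma measurableSet_goodEvent (h : IsRun B ε δ μ 𝓕 S) : MeasurableSet (goodEvent B ε δ S) := by
  have : goodEvent B ε δ S = ⋂ T, ⋂ (_ : 1 ≤ T), {ω | DevBound B ε δ (S ω) T} := by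
    rw [goodEvent_eq]; ext ω; simp
  rw [this]
  exact MeasurableSet.iInter fun T => MeasurableSet.iInter fun _ =>
    𝓕.le T _ (h.measurableSet_devBound T)

end IsRun

/-- The event that the deviation bounds hold up to time `n`. -/
def goodUpTo (B : Problem X K) (ε δ : ℝ) (S : Ω → Transcript X K) (n : ℕ) : Set Ω :=
  {ω | ∀ T, 1 ≤ T → T ≤ n → DevBound B ε δ (S ω) T}

lemma goodEvent_subset_goodUpTo (n : ℕ) : goodEvent B ε δ S ⊆ goodUpTo B ε δ S n := by
  rw [goodEvent_eq]
  exact fun ω hω T h1 _ => hω T h1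

lemma IsRun.measurableSet_goodUpTo (h : IsRun B ε δ μ 𝓕 S) (n : ℕ) :
    MeasurableSet[𝓕 n] (goodUpTo B ε δ S n) := by
  have : goodUpTo B ε δ S n
      = ⋂ T, ⋂ (_ : 1 ≤ T), ⋂ (_ : T ≤ n), {ω | DevBound B ε δ (S ω) T} := by
    ext ω; simp [goodUpTo]
  rw [this]
  exact MeasurableSet.iInter fun T => MeasurableSet.iInter fun _ => MeasurableSet.iInter fun hT =>
    𝓕.mono hT _ (h.measurableSet_devBound T)

end Run

/-! ### Moments of the excess loss on one example. -/

namespace Problem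

variable {X : Type*} [MeasurableSpace X] {K : ℕ} (B : Problem X K)

/-- The excess loss of the policy `π` on one example. -/
def excess (π : X → Fin K) (z : X × (Fin K → ℝ)) : ℝ := z.2 (π z.1) - z.2 (B.opt z.1)

/-- The indicator of a disagreement with the optimal policy. -/
def disagree (π : X → Fin K) (z : X × (Fin K → ℝ)) : ℝ := if π z.1 ≠ B.opt z.1 then 1 else 0

variable {B} {π : X → Fin K}

lemma measurable_loss_apply (hπ : π ∈ B.Pol) :
    Measurable fun z : X × (Fin K → ℝ) => z.2 (π z.1) :=
  measurable_apply_fin (f := fun a (z : X × (Fin K → ℝ)) => z.2 a)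
    (fun a => (measurable_pi_apply a).comp measurable_snd)
    ((B.measurable_pol π hπ).comp measurable_fst)

lemma measurable_excess (hπ : π ∈ B.Pol) : Measurable (B.excess π) :=
  (measurable_loss_apply hπ).sub (measurable_loss_apply B.opt_mem)

lemma measurableSet_ne_opt (hπ : π ∈ B.Pol) : MeasurableSet {x | π x ≠ B.opt x} :=
  (measurableSet_eq_fun (B.measurable_pol π hπ) (B.measurable_pol _ B.opt_mem)).compl

lemma measurable_disagree (hπ : π ∈ B.Pol) : Measurable (B.disagree π) :=
  Measurable.ite (measurable_fst (measurableSet_ne_opt hπ)) measurable_const measurable_const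

lemma integral_disagree (hπ : π ∈ B.Pol) : ∫ z, B.disagree π z ∂B.D = B.rho π B.opt := by
  have h1 : B.disagree π = Set.indicator (Prod.fst ⁻¹' {x | π x ≠ B.opt x}) fun _ => (1 : ℝ) := by
    ext z
    simp [disagree, Set.indicator_apply]
  rw [h1, integral_indicator_const _ (measurable_fst (measurableSet_ne_opt hπ)), smul_eq_mul,
    mul_one, rho, ctxLaw, map_measureReal_apply measurable_fst (measurableSet_ne_opt hπ)]

lemma integrable_loss_apply (hπ : π ∈ B.Pol) : Integrable (fun z => z.2 (π z.1)) B.D := by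
  refine Integrable.of_bound (measurable_loss_apply hπ).aestronglyMeasurable 1 ?_
  filter_upwards [B.loss_mem] with z hz
  rw [Real.norm_eq_abs, abs_of_nonneg (hz _).1]
  exact (hz _).2

lemma abs_excess_le (π : X → Fin K) : ∀ᵐ z ∂B.D, |B.excess π z| ≤ B.disagree π z := by
  filter_upwards [B.loss_mem] with z hz
  unfold excess disagree
  split_ifs with h
  · rw [abs_le]
    constructor <;> linarith [(hz (π z.1)).1, (hz (π z.1)).2, (hz (B.opt z.1)).1,
      (hz (B.opt z.1)).2]
  · push Not at h
    simp [h]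

lemma disagree_le_one (π : X → Fin K) (z : X × (Fin K → ℝ)) : B.disagree π z ≤ 1 := by
  unfold disagree; split_ifs <;> norm_num

lemma disagree_nonneg (π : X → Fin K) (z : X × (Fin K → ℝ)) : 0 ≤ B.disagree π z := by
  unfold disagree; split_ifs <;> norm_num

lemma integrable_disagree (hπ : π ∈ B.Pol) : Integrable (B.disagree π) B.D :=
  Integrable.of_bound (measurable_disagree hπ).aestronglyMeasurable 1 (ae_of_all _ fun z => by
    rw [Real.norm_eq_abs, abs_of_nonneg (disagree_nonneg π z)]
    exact disagree_le_one π z)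

lemma integrable_excess (hπ : π ∈ B.Pol) : Integrable (B.excess π) B.D :=
  (integrable_loss_apply hπ).sub (integrable_loss_apply B.opt_mem)

lemma integral_excess (hπ : π ∈ B.Pol) : ∫ z, B.excess π z ∂B.D = B.risk π - B.risk B.opt :=
  integral_sub (integrable_loss_apply hπ) (integrable_loss_apply B.opt_mem)

lemma risk_sub_le_rho (hπ : π ∈ B.Pol) : B.risk π - B.risk B.opt ≤ B.rho π B.opt := by
  rw [← integral_excess hπ, ← integral_disagree hπ]
  refine integral_mono_ae (integrable_excess hπ) (integrable_disagree hπ) ?_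
  filter_upwards [abs_excess_le (B := B) π] with z hz
  exact (le_abs_self _).trans hz

lemma integrable_excess_sq (hπ : π ∈ B.Pol) : Integrable (fun z => B.excess π z ^ 2) B.D := by
  refine Integrable.of_bound ((measurable_excess hπ).pow_const 2).aestronglyMeasurable 1 ?_
  filter_upwards [abs_excess_le (B := B) π] with z hz
  rw [Real.norm_eq_abs, abs_pow]
  exact pow_le_one₀ (abs_nonneg _) (hz.trans (disagree_le_one π z))

/-- Centering only decreases the second moment, and the squared excess is at most the disagreement
indicator. -/
lemma integral_centered_excess_sq_le (hπ : π ∈ B.Pol) :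
    ∫ z, (B.excess π z - (B.risk π - B.risk B.opt)) ^ 2 ∂B.D ≤ B.rho π B.opt := by
  set r := B.risk π - B.risk B.opt with hr
  have h1 : ∀ z, (B.excess π z - r) ^ 2 = B.excess π z ^ 2 - 2 * r * B.excess π z + r ^ 2 :=
    fun z => by ring
  have h2 : ∫ z, B.excess π z ^ 2 ∂B.D ≤ B.rho π B.opt := by
    rw [← integral_disagree hπ]
    refine integral_mono_ae (integrable_excess_sq hπ) (integrable_disagree hπ) ?_
    filter_upwards [abs_excess_le (B := B) π] with z hz
    have h3 := disagree_le_one (B := B) π z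
    rw [← sq_abs]
    nlinarith [abs_nonneg (B.excess π z)]
  have h4 : Integrable (fun z => 2 * r * B.excess π z) B.D := (integrable_excess hπ).const_mul _
  have h5 : Integrable (fun z => B.excess π z ^ 2 - 2 * r * B.excess π z) B.D :=
    (integrable_excess_sq hπ).sub h4
  simp_rw [h1]
  rw [integral_add h5 (integrable_const _),
    integral_sub (integrable_excess_sq hπ) h4, integral_const_mul, integral_excess hπ, ← hr,
    integral_const]
  simp only [probReal_univ, smul_eq_mul, one_mul]
  nlinarith [sq_nonneg r]

end Problem

/-! ### The two martingale difference sequences of a run. -/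

section Run

variable {X : Type*} [MeasurableSpace X] {K : ℕ} {Ω : Type*} [mΩ : MeasurableSpace Ω]
  {B : Problem X K} {ε δ : ℝ} {μ : Measure Ω}
  {𝓕 : Filtration ℕ mΩ} {S : Ω → Transcript X K}

/-- The difference of the deviations of the loss estimates of `π` and the optimal policy at round
`n + 1`, if the action `c` is played. -/
def estDev (B : Problem X K) (ε δ : ℝ) (S : Transcript X K) (π : X → Fin K)
    (n : ℕ) (c : Fin K) : ℝ :=
  ipsDev ε (S.explored B.Pol ε δ (n + 1)) (S.pol (n + 1) (S.ctx (n + 1))) (S.loss (n + 1)) c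
      (π (S.ctx (n + 1)))
    - ipsDev ε (S.explored B.Pol ε δ (n + 1)) (S.pol (n + 1) (S.ctx (n + 1))) (S.loss (n + 1)) c
      (B.opt (S.ctx (n + 1)))

namespace IsRun

lemma map_sample (h : IsRun B ε δ μ 𝓕 S) (n : ℕ) : μ.map (sample S n) = B.D := h.law n

lemma ae_sample (h : IsRun B ε δ μ 𝓕 S) (n : ℕ) {p : X × (Fin K → ℝ) → Prop}
    (hp : ∀ᵐ z ∂B.D, p z) : ∀ᵐ ω ∂μ, p (sample S n ω) := by
  rw [← h.map_sample n] at hp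
  exact ae_of_ae_map (h.measurable_sample n).aemeasurable hp

lemma ae_loss_mem (h : IsRun B ε δ μ 𝓕 S) :
    ∀ᵐ ω ∂μ, ∀ n a, (S ω).loss (n + 1) a ∈ Set.Icc (0 : ℝ) 1 :=
  ae_all_iff.2 fun n => h.ae_sample n B.loss_mem

lemma integral_sample (h : IsRun B ε δ μ 𝓕 S) (n : ℕ) {g : X × (Fin K → ℝ) → ℝ}
    (hg : Measurable g) : ∫ ω, g (sample S n ω) ∂μ = ∫ z, g z ∂B.D := by
  rw [← h.map_sample n, integral_map (h.measurable_sample n).aemeasurable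
    hg.aestronglyMeasurable]

lemma measurable_estDev (h : IsRun B ε δ μ 𝓕 S) {π : X → Fin K} (hπ : π ∈ B.Pol) (n : ℕ)
    (c : Fin K) : Measurable[preAct 𝓕 S n] fun ω => estDev B ε δ (S ω) π n c :=
  (h.measurable_ipsDev_of (h.measurableSet_mem_explored n) hπ c).sub
    (h.measurable_ipsDev_of (h.measurableSet_mem_explored n) B.opt_mem c)

lemma abs_estDev_le (h : IsRun B ε δ μ 𝓕 S) (hε : 0 < ε) (hε1 : ε ≤ 1) (π : X → Fin K) :
    ∀ᵐ ω ∂μ, ∀ n c, |estDev B ε δ (S ω) π n c| ≤ K / ε + 1 := by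
  filter_upwards [h.ae_loss_mem] with ω hω n c
  exact abs_ipsDev_sub_le hε hε1 (hω n) _ _ _

variable [IsProbabilityMeasure μ]

lemma condExp_sample (h : IsRun B ε δ μ 𝓕 S) (n : ℕ) {g : X × (Fin K → ℝ) → ℝ}
    (hg : Measurable g) :
    μ[fun ω => g (sample S n ω) | 𝓕 n] =ᵐ[μ] fun _ => ∫ z, g z ∂B.D := by
  have := condExp_indep_eq (f := fun ω => g (sample S n ω)) (h.measurable_sample n).comap_le
    (𝓕.le n) (hg.comp (comap_measurable (sample S n))).stronglyMeasurable (h.indep n)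
  rwa [h.integral_sample n hg] at this

/-- Averaging over the action of round `n + 1`. -/
lemma condExp_act (h : IsRun B ε δ μ 𝓕 S) (n : ℕ) {f : Fin K → Ω → ℝ} {C : ℝ}
    (hf : ∀ c, Measurable[preAct 𝓕 S n] (f c)) (hC : ∀ c, ∀ᵐ ω ∂μ, |f c ω| ≤ C) :
    μ[fun ω => f ((S ω).act (n + 1)) ω | preAct 𝓕 S n] =ᵐ[μ]
      fun ω => ∑ c, (S ω).prob B.Pol ε δ (n + 1) c * f c ω := by
  -- Finitely many actions: expand in the indicators of the played action and pull out the factors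
  -- known before it is drawn.
  set i : Fin K → Ω → ℝ := fun c ω => if (S ω).act (n + 1) = c then (1 : ℝ) else 0 with hi
  have hi_int : ∀ c, Integrable (i c) μ := fun c => by
    refine Integrable.of_bound (Measurable.aestronglyMeasurable ?_) 1 (ae_of_all _ fun ω => ?_)
    · exact Measurable.ite (𝓕.le _ _ (h.act_meas n (measurableSet_singleton c))) measurable_const
        measurable_const
    · simp only [hi]; split_ifs <;> simp
  have hfi : ∀ c, Integrable (f c * i c) μ := fun c =>
    (hi_int c).bdd_mul ((hf c).mono (h.preAct_le n) le_rfl).aestronglyMeasurable (hC c)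
  have e1 : (fun ω => f ((S ω).act (n + 1)) ω) = ∑ c, f c * i c := by
    ext ω
    simp [hi]
  rw [e1]
  have e2 := condExp_finsetSum (μ := μ) (s := Finset.univ) (f := fun c => f c * i c)
    (fun c _ => hfi c) (preAct 𝓕 S n)
  have e3 : ∀ᵐ ω ∂μ, ∀ c, (μ[f c * i c | preAct 𝓕 S n]) ω
      = f c ω * (S ω).prob B.Pol ε δ (n + 1) c := by
    rw [ae_all_iff]
    intro c
    have e4 := condExp_mul_of_stronglyMeasurable_left (hf c).stronglyMeasurable (hfi c) (hi_int c)
    filter_upwards [e4, h.act_law n c] with ω h4 h5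
    rw [h4, Pi.mul_apply]
    congr 1
  filter_upwards [e2, e3] with ω h2 h3
  rw [h2, Finset.sum_apply]
  exact Finset.sum_congr rfl fun c _ => by rw [h3 c, mul_comm]

lemma isBoundedMartingaleDiff_excess (h : IsRun B ε δ μ 𝓕 S) {π : X → Fin K} (hπ : π ∈ B.Pol) :
    IsBoundedMartingaleDiff μ 𝓕
      (fun n ω => B.excess π (sample S n ω) - (B.risk π - B.risk B.opt)) 2 (B.rho π B.opt) where
  meas n := ((Problem.measurable_excess hπ).comp (h.measurable_sample_succ n)).sub_const _
  bound n := by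
    filter_upwards [h.ae_sample n (Problem.abs_excess_le (B := B) π)] with ω hω
    have h1 := B.risk_opt_le hπ
    have h2 := (Problem.risk_sub_le_rho hπ).trans (B.rho_le_one π B.opt)
    have h3 := abs_le.1 (hω.trans (Problem.disagree_le_one (B := B) π _))
    rw [abs_le]
    constructor <;> linarith [h3.1, h3.2]
  mean n := by
    refine (h.condExp_sample n ((Problem.measurable_excess hπ).sub_const _)).trans
      (ae_of_all _ fun ω => ?_)
    simp only [Pi.zero_apply]
    rw [integral_sub (Problem.integrable_excess hπ) (integrable_const _),
      Problem.integral_excess hπ, integral_const]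
    simp
  var n := by
    filter_upwards [h.condExp_sample n
      (((Problem.measurable_excess hπ).sub_const (B.risk π - B.risk B.opt)).pow_const 2)] with ω hω
    rw [hω]
    exact Problem.integral_centered_excess_sq_le hπ

/-- Conditioning in two stages: averaging over the action alone gives mean 0 and variance at most
2K/ε times the disagreement indicator; averaging then over the context turns the indicator into ρ.
-/
lemma isBoundedMartingaleDiff_estDev (h : IsRun B ε δ μ 𝓕 S) (hε : 0 < ε) (hε1 : ε ≤ 1)
    (hδ : 0 < δ) (hδ1 : δ < 1) {π : X → Fin K} (hπ : π ∈ B.Pol) :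
    IsBoundedMartingaleDiff μ 𝓕 (fun n ω => estDev B ε δ (S ω) π n ((S ω).act (n + 1)))
      (K / ε + 1) (2 * K / ε * B.rho π B.opt) where
  meas n := measurable_apply_fin (f := fun c ω => estDev B ε δ (S ω) π n c)
    (fun c => (h.measurable_estDev hπ n c).mono (h.preAct_le_succ n) le_rfl) (h.act_meas n)
  bound n := by
    filter_upwards [h.abs_estDev_le hε hε1 π] with ω hω
    exact hω _ _
  mean n := by
    have h1 := h.condExp_act n (h.measurable_estDev hπ n)
      (fun c => (h.abs_estDev_le hε hε1 π).mono fun ω hω => hω n c)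
    have h2 : μ[fun ω => estDev B ε δ (S ω) π n ((S ω).act (n + 1)) | preAct 𝓕 S n] =ᵐ[μ] 0 := by
      filter_upwards [h1] with ω hω
      rw [hω]
      exact sum_playProb_mul_ipsDev_sub hε hε1 (pol_mem_explored hε hδ hδ1 (h.pol_oracle n ω)) _ _ _
    have h3 := condExp_condExp_of_le (μ := μ)
      (f := fun ω => estDev B ε δ (S ω) π n ((S ω).act (n + 1))) (le_preAct 𝓕 S n) (h.preAct_le n)
    refine h3.symm.trans ((condExp_congr_ae h2).trans ?_)
    rw [condExp_zero]
  var n := by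
    have hbd : ∀ c, ∀ᵐ ω ∂μ, |estDev B ε δ (S ω) π n c ^ 2| ≤ (K / ε + 1) ^ 2 := fun c =>
      (h.abs_estDev_le hε hε1 π).mono fun ω hω => by
        rw [abs_pow]
        exact pow_le_pow_left₀ (abs_nonneg _) (hω n c) 2
    have h1 := h.condExp_act n (fun c => (h.measurable_estDev hπ n c).pow_const 2) hbd
    have h2 : μ[fun ω => estDev B ε δ (S ω) π n ((S ω).act (n + 1)) ^ 2 | preAct 𝓕 S n]
        ≤ᵐ[μ] fun ω => 2 * K / ε * B.disagree π (sample S n ω) := by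
      filter_upwards [h1, h.ae_loss_mem] with ω hω hl
      rw [hω]
      exact sum_playProb_mul_ipsDev_sub_sq_le hε hε1
        (pol_mem_explored hε hδ hδ1 (h.pol_oracle n ω)) (hl n) _ _
    have h3 := condExp_condExp_of_le (μ := μ)
      (f := fun ω => estDev B ε δ (S ω) π n ((S ω).act (n + 1)) ^ 2)
      (le_preAct 𝓕 S n) (h.preAct_le n)
    have hmd := ((Problem.measurable_disagree hπ).const_mul (2 * K / ε))
    have hint : Integrable (fun ω => 2 * K / ε * B.disagree π (sample S n ω)) μ := by
      have := (Problem.integrable_disagree hπ).const_mul (2 * K / ε)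
      rw [← h.map_sample n] at this
      exact this.comp_measurable (h.measurable_sample n)
    have h4 := condExp_mono (m := 𝓕 n) integrable_condExp hint h2
    have h5 := h.condExp_sample n hmd
    filter_upwards [h3, h4, h5] with ω e3 e4 e5
    rw [← e3]
    refine e4.trans (le_of_eq ?_)
    rw [e5, integral_const_mul, Problem.integral_disagree hπ]

end IsRun

end Run

/-! ### The probability of the good event. -/

lemma exp_neg_log_div_deltaT {N : ℕ} (hN : 1 ≤ N) {δ : ℝ} (hδ : 0 < δ) {T : ℕ} (hT : 1 ≤ T) :
    Real.exp (-Real.log (2 * N / deltaT δ T)) = deltaT δ T / (2 * N) := by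
  have hT0 : (0 : ℝ) < T := by exact_mod_cast hT
  have hN0 : (0 : ℝ) < N := by exact_mod_cast hN
  have h1 : 0 < deltaT δ T := by unfold deltaT; positivity
  rw [Real.exp_neg, Real.exp_log (by positivity), inv_div]

/-- The sum telescopes, as δ_T = δ/T - δ/(T+1). -/
lemma sum_deltaT_le {δ : ℝ} (hδ : 0 < δ) {m : ℕ} (hm : 1 ≤ m) (M : ℕ) :
    ∑ i ∈ Finset.range M, deltaT δ (m + i) ≤ δ / m := by
  have hm0 : (0 : ℝ) < m := by exact_mod_cast hm
  have key : ∑ i ∈ Finset.range M, deltaT δ (m + i) = δ / m - δ / (m + M) := by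
    induction M with
    | zero => simp
    | succ M ih =>
      rw [Finset.sum_range_succ, ih]
      unfold deltaT
      push_cast
      field_simp
      ring
  rw [key]
  have : 0 ≤ δ / (m + M) := by positivity
  linarith

section Deviation

variable {Ω : Type*} [mΩ : MeasurableSpace Ω] {μ : Measure Ω}
  {𝓕 : Filtration ℕ mΩ} {Y : ℕ → Ω → ℝ} {b v : ℝ}

/-- With l = log(2N/δ_T) = T e_T / 2, the Bernstein width divided by T is √(v e_T) + b e_T, and the
two tails cost 2 exp(-l) = δ_T / N. -/
lemma IsBoundedMartingaleDiff.measureReal_not_le [IsProbabilityMeasure μ]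
    (h : IsBoundedMartingaleDiff μ 𝓕 Y b v)
    (hb : 0 < b) (hv : 0 ≤ v) {N : ℕ} (hN : 1 ≤ N) {δ : ℝ} (hδ : 0 < δ) (hδ1 : δ < 1)
    {T : ℕ} (hT : 1 ≤ T) :
    μ.real {ω | ¬ |(∑ k ∈ Finset.range T, Y k ω) / T|
      ≤ Real.sqrt (v * eT N δ T) + b * eT N δ T} ≤ deltaT δ T / N := by
  have hT0 : (0 : ℝ) < T := by exact_mod_cast hT
  have hl := one_le_log_div_deltaT hN hδ hδ1 hT
  have h1 := h.measureReal_abs_sum_ge_le hb hv hT (zero_lt_one.trans_le hl)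
  rw [exp_neg_log_div_deltaT hN hδ hT] at h1
  have h2 : 2 * (deltaT δ T / (2 * N)) = deltaT δ T / N := by ring
  rw [h2] at h1
  refine (measureReal_mono fun ω hω => ?_).trans h1
  rw [Set.mem_ofPred_eq, not_le, abs_div, abs_of_pos hT0, lt_div_iff₀ hT0] at hω
  refine le_of_eq_of_le ?_ hω.le
  rw [eT_eq]
  set l := Real.log (2 * N / deltaT δ T)
  have h3 : 2 * T * v * l = v * (2 * l / T) * T ^ 2 := by field_simp
  rw [h3, Real.sqrt_mul (by positivity), Real.sqrt_sq hT0.le]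
  field_simp

lemma IsBoundedMartingaleDiff.ae_le_of_one_le (h : IsBoundedMartingaleDiff μ 𝓕 Y b v)
    (hb : 0 < b) {T : ℕ} (hT : 1 ≤ T) {e : ℝ} (he : 1 ≤ e) :
    ∀ᵐ ω ∂μ, |(∑ k ∈ Finset.range T, Y k ω) / T| ≤ Real.sqrt (v * e) + b * e := by
  have hT0 : (0 : ℝ) < T := by exact_mod_cast hT
  filter_upwards [h.abs_sum_le T] with ω hω
  rw [abs_div, abs_of_pos hT0]
  have h1 : |∑ k ∈ Finset.range T, Y k ω| / T ≤ b := by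
    rw [div_le_iff₀ hT0]; linarith
  nlinarith [Real.sqrt_nonneg (v * e)]

end Deviation

/-- The deviation bounds in terms of sums of martingale differences. -/
lemma devBound_iff {X : Type*} [MeasurableSpace X] {K : ℕ} {Ω : Type*} (B : Problem X K)
    (ε δ : ℝ) (S : Ω → Transcript X K) (ω : Ω) {T : ℕ} (hT : 1 ≤ T) :
    DevBound B ε δ (S ω) T ↔ ∀ π ∈ B.Pol,
      |(∑ n ∈ Finset.range T, estDev B ε δ (S ω) π n ((S ω).act (n + 1))) / T|
        ≤ Real.sqrt (2 * K / ε * B.rho π B.opt * eT B.Pol.card δ T)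
          + (K / ε + 1) * eT B.Pol.card δ T ∧
      |(∑ n ∈ Finset.range T, (B.excess π (sample S n ω) - (B.risk π - B.risk B.opt))) / T|
        ≤ Real.sqrt (B.rho π B.opt * eT B.Pol.card δ T) + 2 * eT B.Pol.card δ T := by
  have hT0 : (T : ℝ) ≠ 0 := by exact_mod_cast (by omega : T ≠ 0)
  refine forall₂_congr fun π _ => ?_
  have h1 : (2 * K / ε * B.rho π B.opt * eT B.Pol.card δ T : ℝ)
      = 2 * K * B.rho π B.opt * eT B.Pol.card δ T / ε := by ring
  have h2 : (∑ n ∈ Finset.range T, estDev B ε δ (S ω) π n ((S ω).act (n + 1))) / T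
      = (empLoss ((S ω).hatSample B.Pol ε δ T) π - empLoss ((S ω).hatSample B.Pol ε δ T) B.opt)
        - (empLoss ((S ω).tildeSample B.Pol ε δ T) π
          - empLoss ((S ω).tildeSample B.Pol ε δ T) B.opt) := by
    simp_rw [Transcript.empLoss_hatSample, Transcript.empLoss_tildeSample, ← sub_div,
      ← Finset.sum_sub_distrib]
    congr 1
    refine Finset.sum_congr rfl fun n _ => ?_
    unfold estDev
    rw [← Transcript.hatLoss_sub_tildeLoss, ← Transcript.hatLoss_sub_tildeLoss]
    ring
  have h3 : (∑ n ∈ Finset.range T, (B.excess π (sample S n ω) - (B.risk π - B.risk B.opt))) / T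
      = (empLoss ((S ω).trueSample T) π - empLoss ((S ω).trueSample T) B.opt)
        - (B.risk π - B.risk B.opt) := by
    simp_rw [Transcript.empLoss_trueSample, ← sub_div, ← Finset.sum_sub_distrib]
    rw [Finset.sum_sub_distrib, Finset.sum_const, Finset.card_range, nsmul_eq_mul, sub_div,
      mul_div_cancel_left₀ _ hT0]
    rfl
  rw [h1, h2, h3]

section Run

variable {X : Type*} [MeasurableSpace X] {K : ℕ} {Ω : Type*} [mΩ : MeasurableSpace Ω]
  {B : Problem X K} {ε δ : ℝ} {μ : Measure Ω}
  {𝓕 : Filtration ℕ mΩ} {S : Ω → Transcript X K}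

variable [IsProbabilityMeasure μ]

namespace IsRun

/-- Union bound over two martingales for each of the N policies, each failing with probability at
most δ_T / N. -/
lemma measureReal_not_devBound_le (h : IsRun B ε δ μ 𝓕 S) (hε : 0 < ε) (hε1 : ε ≤ 1)
    (hδ : 0 < δ) (hδ1 : δ < 1) {T : ℕ} (hT : 1 ≤ T) :
    μ.real {ω | ¬ DevBound B ε δ (S ω) T} ≤ 2 * deltaT δ T := by
  have hN := B.one_le_card
  have hN0 : (0 : ℝ) < B.Pol.card := by exact_mod_cast hN
  set F₁ : (X → Fin K) → Set Ω := fun π =>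
    {ω | ¬ |(∑ n ∈ Finset.range T, estDev B ε δ (S ω) π n ((S ω).act (n + 1))) / T|
        ≤ Real.sqrt (2 * K / ε * B.rho π B.opt * eT B.Pol.card δ T)
          + (K / ε + 1) * eT B.Pol.card δ T}
  set F₂ : (X → Fin K) → Set Ω := fun π =>
    {ω | ¬ |(∑ n ∈ Finset.range T, (B.excess π (sample S n ω) - (B.risk π - B.risk B.opt))) / T|
        ≤ Real.sqrt (B.rho π B.opt * eT B.Pol.card δ T) + 2 * eT B.Pol.card δ T}
  have hsub : {ω | ¬ DevBound B ε δ (S ω) T} ⊆ ⋃ π ∈ B.Pol, (F₁ π ∪ F₂ π) := by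
    intro ω hω
    rw [Set.mem_ofPred_eq, devBound_iff B ε δ S ω hT] at hω
    push Not at hω
    obtain ⟨π, hπ, hω⟩ := hω
    simp only [Set.mem_iUnion]
    refine ⟨π, hπ, ?_⟩
    by_cases h1 : ω ∈ F₁ π
    · exact Or.inl h1
    · exact Or.inr (not_le.2 (hω (not_not.1 h1)))
  calc μ.real {ω | ¬ DevBound B ε δ (S ω) T} ≤ μ.real (⋃ π ∈ B.Pol, (F₁ π ∪ F₂ π)) :=
        measureReal_mono hsub (measure_ne_top _ _)
    _ ≤ ∑ π ∈ B.Pol, μ.real (F₁ π ∪ F₂ π) := measureReal_biUnion_finset_le _ _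
    _ ≤ ∑ _π ∈ B.Pol, (deltaT δ T / B.Pol.card + deltaT δ T / B.Pol.card) := by
        refine Finset.sum_le_sum fun π hπ => (measureReal_union_le _ _).trans (add_le_add ?_ ?_)
        · exact (h.isBoundedMartingaleDiff_estDev hε hε1 hδ hδ1 hπ).measureReal_not_le
            (by positivity) (mul_nonneg (by positivity) (B.rho_nonneg _ _)) hN hδ hδ1 hT
        · exact (h.isBoundedMartingaleDiff_excess hπ).measureReal_not_le
            (by positivity) (B.rho_nonneg _ _) hN hδ hδ1 hT
    _ = 2 * deltaT δ T := by
        rw [Finset.sum_const, nsmul_eq_mul]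
        field_simp
        ring

/-- Here e_T ≥ 1, so the term b e_T alone exceeds the trivial bound b on an average of T
differences. -/
lemma ae_devBound (h : IsRun B ε δ μ 𝓕 S) (hε : 0 < ε) (hε1 : ε ≤ 1)
    (hδ : 0 < δ) (hδ1 : δ < 1) {T : ℕ} (hT : 1 ≤ T) (hT3 : T ≤ 3) :
    ∀ᵐ ω ∂μ, DevBound B ε δ (S ω) T := by
  have he := one_le_eT B.one_le_card hδ hδ1 hT hT3
  have : ∀ᵐ ω ∂μ, ∀ π ∈ B.Pol, _ ∧ _ := (ae_ball_iff (Finset.countable_toSet B.Pol)).2 fun π hπ =>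
    ((h.isBoundedMartingaleDiff_estDev hε hε1 hδ hδ1 hπ).ae_le_of_one_le
      (by positivity) hT he).and
    ((h.isBoundedMartingaleDiff_excess hπ).ae_le_of_one_le (by positivity) hT he)
  filter_upwards [this] with ω hω
  exact (devBound_iff B ε δ S ω hT).2 hω

/-- Failures of the deviation bounds from time `m` on are unlikely. -/
lemma measureReal_exists_not_devBound_le (h : IsRun B ε δ μ 𝓕 S) (hε : 0 < ε) (hε1 : ε ≤ 1)
    (hδ : 0 < δ) (hδ1 : δ < 1) {m : ℕ} (hm : 1 ≤ m) :
    μ.real {ω | ∃ T, m ≤ T ∧ ¬ DevBound B ε δ (S ω) T} ≤ 2 * (δ / m) := by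
  have hset : {ω | ∃ T, m ≤ T ∧ ¬ DevBound B ε δ (S ω) T}
      = ⋃ i, {ω | ¬ DevBound B ε δ (S ω) (m + i)} := by
    ext ω
    simp only [Set.mem_ofPred_eq, Set.mem_iUnion]
    constructor
    · rintro ⟨T, hT, h⟩
      exact ⟨T - m, by rwa [Nat.add_sub_cancel' hT]⟩
    · rintro ⟨i, h⟩
      exact ⟨m + i, by omega, h⟩
  have h1 : μ {ω | ∃ T, m ≤ T ∧ ¬ DevBound B ε δ (S ω) T} ≤ ENNReal.ofReal (2 * (δ / m)) := by
    rw [hset]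
    refine (measure_iUnion_le _).trans (ENNReal.tsum_le_of_sum_range_le fun M => ?_)
    calc ∑ i ∈ Finset.range M, μ {ω | ¬ DevBound B ε δ (S ω) (m + i)}
        = ENNReal.ofReal (∑ i ∈ Finset.range M, μ.real {ω | ¬ DevBound B ε δ (S ω) (m + i)}) := by
          rw [ENNReal.ofReal_sum_of_nonneg fun _ _ => measureReal_nonneg]
          exact Finset.sum_congr rfl fun i _ => (ofReal_measureReal).symm
      _ ≤ ENNReal.ofReal (2 * (δ / m)) := by
          refine ENNReal.ofReal_le_ofReal ?_
          calc _ ≤ ∑ i ∈ Finset.range M, 2 * deltaT δ (m + i) :=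
                Finset.sum_le_sum fun i _ =>
                  h.measureReal_not_devBound_le hε hε1 hδ hδ1 (by omega)
            _ = 2 * ∑ i ∈ Finset.range M, deltaT δ (m + i) := by rw [Finset.mul_sum]
            _ ≤ _ := by gcongr; exact sum_deltaT_le hδ hm M
  rw [measureReal_def]
  exact ENNReal.toReal_le_of_le_ofReal (by positivity) h1

/-- On this difference the first failure occurs at time n + 1 or later. -/
lemma measureReal_goodUpTo_diff_le (h : IsRun B ε δ μ 𝓕 S) (hε : 0 < ε) (hε1 : ε ≤ 1)
    (hδ : 0 < δ) (hδ1 : δ < 1) (n : ℕ) :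
    μ.real (goodUpTo B ε δ S n \ goodEvent B ε δ S) ≤ 2 * (δ / (n + 1 : ℕ)) := by
  refine (measureReal_mono fun ω hω => ?_).trans
    (h.measureReal_exists_not_devBound_le hε hε1 hδ hδ1 (by omega : 1 ≤ n + 1))
  obtain ⟨h1, h2⟩ := hω
  rw [goodEvent_eq, Set.mem_ofPred_eq] at h2
  push Not at h2
  obtain ⟨T, hT, h3⟩ := h2
  refine ⟨T, ?_, h3⟩
  by_contra hlt
  exact h3 (h1 T hT (by omega))

/-- Failures can only start at T = 4, so the total is at most 2δ/4. Summing from T = 1 would give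
2δ, which is useless for δ near 1. -/
lemma measureReal_goodEvent_ge (h : IsRun B ε δ μ 𝓕 S) (hε : 0 < ε) (hε1 : ε ≤ 1)
    (hδ : 0 < δ) (hδ1 : δ < 1) : 1 - δ / 2 ≤ μ.real (goodEvent B ε δ S) := by
  have h1 : μ.real (goodUpTo B ε δ S 3) = 1 := by
    have h3 : ∀ᵐ ω ∂μ, ω ∈ goodUpTo B ε δ S 3 := by
      have : ∀ᵐ ω ∂μ, ∀ T ∈ Finset.Icc 1 3, DevBound B ε δ (S ω) T :=
        (ae_ball_iff (Finset.countable_toSet _)).2 fun T hT =>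
          h.ae_devBound hε hε1 hδ hδ1 (Finset.mem_Icc.1 hT).1 (Finset.mem_Icc.1 hT).2
      filter_upwards [this] with ω hω T h1 h2
      exact hω T (Finset.mem_Icc.2 ⟨h1, h2⟩)
    rw [measureReal_def, (mem_ae_iff_prob_eq_one (𝓕.le _ _ (h.measurableSet_goodUpTo 3))).1 h3,
      ENNReal.toReal_one]
  have h2 := h.measureReal_goodUpTo_diff_le hε hε1 hδ hδ1 3
  have h3 := measureReal_sdiff (μ := μ) (goodEvent_subset_goodUpTo (B := B) (ε := ε) (δ := δ)
    (S := S) 3) h.measurableSet_goodEvent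
  rw [h3, h1] at h2
  push_cast at h2
  linarith

end IsRun

end Run

/-! ### The disagreement coefficient, and what a policy at positive distance forces. -/

namespace Problem

variable {X : Type*} [MeasurableSpace X] {K : ℕ} (B : Problem X K)

lemma disRegion_eq (r : ℝ) : B.disRegion r
    = ⋃ π ∈ B.Pol.filter fun π => B.rho π B.opt ≤ r, {x | π x ≠ B.opt x} := by
  ext x
  simp [disRegion, and_assoc]

lemma measurableSet_disRegion (r : ℝ) : MeasurableSet (B.disRegion r) := by
  rw [disRegion_eq]
  exact Finset.measurableSet_biUnion _ fun π hπ =>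
    measurableSet_ne_opt (Finset.mem_filter.1 hπ).1

lemma measureReal_disRegion_le (r : ℝ) : B.ctxLaw.real (B.disRegion r)
    ≤ ∑ π ∈ B.Pol.filter fun π => B.rho π B.opt ≤ r, B.rho π B.opt := by
  rw [disRegion_eq]
  exact measureReal_biUnion_finset_le _ _

/-- Each of the policies within distance r contributes at most r. Boundedness is what makes the real
supremum an upper bound. -/
lemma bddAbove_disRegion : BddAbove (Set.range fun r : Set.Ioi (0 : ℝ) =>
    B.ctxLaw.real (B.disRegion r) / (r : ℝ)) := by
  refine ⟨B.Pol.card, ?_⟩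
  rintro _ ⟨⟨r, hr⟩, rfl⟩
  have hr0 : 0 < r := hr
  simp only
  rw [div_le_iff₀ hr0]
  calc B.ctxLaw.real (B.disRegion r)
      ≤ ∑ π ∈ B.Pol.filter fun π => B.rho π B.opt ≤ r, B.rho π B.opt := B.measureReal_disRegion_le r
    _ ≤ ∑ π ∈ B.Pol.filter fun π => B.rho π B.opt ≤ r, r :=
        Finset.sum_le_sum fun π hπ => (Finset.mem_filter.1 hπ).2
    _ = (B.Pol.filter fun π => B.rho π B.opt ≤ r).card * r := by simp
    _ ≤ B.Pol.card * r := by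
        gcongr
        exact Finset.filter_subset _ _

lemma measureReal_disRegion_le_disCoeff {r : ℝ} (hr : 0 < r) :
    B.ctxLaw.real (B.disRegion r) ≤ B.disCoeff * r := by
  rw [← div_le_iff₀ hr]
  exact le_ciSup B.bddAbove_disRegion ⟨r, hr⟩

lemma disCoeff_nonneg : 0 ≤ B.disCoeff := by
  have := B.measureReal_disRegion_le_disCoeff one_pos
  rw [mul_one] at this
  exact measureReal_nonneg.trans this

/-- At radius ρ(π, π*) the region contains all disagreements of π itself. -/
lemma one_le_disCoeff {π : X → Fin K} (hπ : π ∈ B.Pol) (h : 0 < B.rho π B.opt) :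
    1 ≤ B.disCoeff := by
  have h1 := B.measureReal_disRegion_le_disCoeff h
  have h2 : B.rho π B.opt ≤ B.ctxLaw.real (B.disRegion (B.rho π B.opt)) :=
    measureReal_mono fun x hx => ⟨π, hπ, le_rfl, hx⟩
  nlinarith

/-- The losses lie in [0, 1], so ρ ≤ (excess risk)/τ ≤ ρ/τ. -/
lemma Massart.le_one {B : Problem X K} {τ : ℝ} (hτ : B.Massart τ) {π : X → Fin K}
    (hπ : π ∈ B.Pol) (h : 0 < B.rho π B.opt) : τ ≤ 1 := by
  have h1 := hτ.2 π hπ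
  have h2 := risk_sub_le_rho hπ
  rw [one_div, inv_mul_eq_div, le_div_iff₀ hτ.1] at h1
  nlinarith

lemma measureReal_disRegion_eq_zero (h : ∀ π ∈ B.Pol, B.rho π B.opt = 0) (r : ℝ) :
    B.ctxLaw.real (B.disRegion r) = 0 := by
  refine le_antisymm ((B.measureReal_disRegion_le r).trans (le_of_eq ?_)) measureReal_nonneg
  exact Finset.sum_eq_zero fun π hπ => h π (Finset.mem_filter.1 hπ).1

end Problem

/-! ### Decomposition of the regret of one round. -/

section Run

variable {X : Type*} [MeasurableSpace X] {K : ℕ} {Ω : Type*} [mΩ : MeasurableSpace Ω]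
  {B : Problem X K} {ε δ : ℝ} {μ : Measure Ω}
  {𝓕 : Filtration ℕ mΩ} {S : Ω → Transcript X K}

/-- The regret of round `n + 1`. -/
def roundRegret (B : Problem X K) (S : Transcript X K) (n : ℕ) : ℝ :=
  S.loss (n + 1) (S.act (n + 1)) - S.loss (n + 1) (B.opt (S.ctx (n + 1)))

lemma regret_eq_sum (B : Problem X K) (S : Transcript X K) (T : ℕ) :
    S.regret B.opt T = ∑ n ∈ Finset.range T, roundRegret B S n := by
  unfold Transcript.regret
  induction T with
  | zero => simp
  | succ T ih => rw [Finset.sum_Icc_succ_top (by omega), ih, Finset.sum_range_succ]; rfl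

namespace IsRun

lemma measurable_roundRegret (h : IsRun B ε δ μ 𝓕 S) (n : ℕ) :
    Measurable fun ω => roundRegret B (S ω) n := by
  refine Measurable.mono (Measurable.sub ?_ ?_) (𝓕.le (n + 1)) le_rfl
  · exact measurable_apply_fin (f := fun a ω => (S ω).loss (n + 1) a)
      (fun a => (h.measurable_loss n a).mono (h.preAct_le_succ n) le_rfl) (h.act_meas n)
  · exact (h.measurable_loss_pol n B.opt_mem).mono (h.preAct_le_succ n) le_rfl

lemma abs_roundRegret_le (h : IsRun B ε δ μ 𝓕 S) (n : ℕ) :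
    ∀ᵐ ω ∂μ, |roundRegret B (S ω) n| ≤ 1 := by
  filter_upwards [h.ae_loss_mem] with ω hω
  unfold roundRegret
  have h1 := hω n ((S ω).act (n + 1))
  have h2 := hω n (B.opt ((S ω).ctx (n + 1)))
  rw [abs_le]
  constructor <;> linarith [h1.1, h1.2, h2.1, h2.2]

lemma measurable_excess_pol (h : IsRun B ε δ μ 𝓕 S) (n : ℕ) :
    Measurable fun ω => B.excess ((S ω).pol (n + 1)) (sample S n ω) := by
  refine Measurable.mono (Measurable.sub ?_ ?_) (h.preAct_le n) le_rfl
  · exact measurable_apply_fin (f := fun a ω => (S ω).loss (n + 1) a)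
      (h.measurable_loss n) (h.measurable_greedy n)
  · exact h.measurable_loss_pol n B.opt_mem

lemma abs_excess_pol_le (h : IsRun B ε δ μ 𝓕 S) (n : ℕ) :
    ∀ᵐ ω ∂μ, |B.excess ((S ω).pol (n + 1)) (sample S n ω)| ≤ 1 := by
  filter_upwards [h.ae_loss_mem] with ω hω
  have h1 := hω n ((S ω).pol (n + 1) ((S ω).ctx (n + 1)))
  have h2 := hω n (B.opt ((S ω).ctx (n + 1)))
  unfold Problem.excess sample
  rw [abs_le]
  constructor <;> linarith [h1.1, h1.2, h2.1, h2.2]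

variable [IsProbabilityMeasure μ]

lemma integrable_roundRegret (h : IsRun B ε δ μ 𝓕 S) (n : ℕ) :
    Integrable (fun ω => roundRegret B (S ω) n) μ :=
  Integrable.of_bound (h.measurable_roundRegret n).aestronglyMeasurable 1 (h.abs_roundRegret_le n)

lemma integrable_excess_pol (h : IsRun B ε δ μ 𝓕 S) (n : ℕ) :
    Integrable (fun ω => B.excess ((S ω).pol (n + 1)) (sample S n ω)) μ :=
  Integrable.of_bound (h.measurable_excess_pol n).aestronglyMeasurable 1 (h.abs_excess_pol_le n)

/-- The conditional expectation of the excess loss of the current policy is its excess risk. -/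
lemma condExp_excess_pol (h : IsRun B ε δ μ 𝓕 S) (n : ℕ) :
    μ[fun ω => B.excess ((S ω).pol (n + 1)) (sample S n ω) | 𝓕 n] =ᵐ[μ]
      fun ω => B.risk ((S ω).pol (n + 1)) - B.risk B.opt := by
  classical
  set i : (X → Fin K) → Ω → ℝ := fun π ω => if (S ω).pol (n + 1) = π then 1 else 0 with hi
  set g : (X → Fin K) → Ω → ℝ := fun π ω => B.excess π (sample S n ω)
  have e1 : (fun ω => B.excess ((S ω).pol (n + 1)) (sample S n ω)) = ∑ π ∈ B.Pol, i π * g π := by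
    ext ω
    simp [hi, g, (h.pol_oracle n ω).1]
  have hg : ∀ π ∈ B.Pol, Integrable (g π) μ := fun π hπ => by
    have := Problem.integrable_excess hπ
    rw [← h.map_sample n] at this
    exact this.comp_measurable (h.measurable_sample n)
  have him : ∀ π ∈ B.Pol, Measurable[𝓕 n] (i π) := fun π hπ =>
    Measurable.ite (h.pol_meas n π hπ) measurable_const measurable_const
  have hig : ∀ π ∈ B.Pol, Integrable (i π * g π) μ := fun π hπ =>
    (hg π hπ).bdd_mul (c := 1) ((him π hπ).mono (𝓕.le n) le_rfl).aestronglyMeasurable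
      (ae_of_all _ fun ω => by simp only [hi]; split_ifs <;> simp)
  rw [e1]
  have e2 := condExp_finsetSum (μ := μ) hig (𝓕 n)
  have e3 : ∀ᵐ ω ∂μ, ∀ π ∈ B.Pol, (μ[i π * g π | 𝓕 n]) ω
      = i π ω * (B.risk π - B.risk B.opt) := by
    refine (ae_ball_iff (Finset.countable_toSet B.Pol)).2 fun π hπ => ?_
    filter_upwards [condExp_mul_of_stronglyMeasurable_left (him π hπ).stronglyMeasurable
      (hig π hπ) (hg π hπ), h.condExp_sample n (Problem.measurable_excess hπ)] with ω h1 h2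
    rw [h1, Pi.mul_apply, h2, Problem.integral_excess hπ]
  filter_upwards [e2, e3] with ω h2 h3
  rw [h2, Finset.sum_apply, Finset.sum_congr rfl h3]
  simp [hi, (h.pol_oracle n ω).1]

/-- Because G is known at time n, the excess loss may be replaced by its conditional expectation,
the excess risk of the current policy. -/
lemma setIntegral_excess_pol_le (h : IsRun B ε δ μ 𝓕 S) {n : ℕ} {G : Set Ω}
    (hG : MeasurableSet[𝓕 n] G) {c : ℝ} (hc : 0 ≤ c)
    (hb : ∀ᵐ ω ∂μ, ω ∈ G → B.risk ((S ω).pol (n + 1)) - B.risk B.opt ≤ c) :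
    ∫ ω in G, B.excess ((S ω).pol (n + 1)) (sample S n ω) ∂μ ≤ c := by
  have h1 := h.condExp_excess_pol n
  rw [← setIntegral_condExp (𝓕.le n) (h.integrable_excess_pol n) hG]
  calc _ ≤ ∫ _ in G, c ∂μ := by
        refine setIntegral_mono_on_ae integrable_condExp.integrableOn
          (integrable_const c).integrableOn (𝓕.le n _ hG) ?_
        filter_upwards [h1, hb] with ω h2 h3 hω
        rw [h2]
        exact h3 hω
    _ = μ.real G * c := by simp
    _ ≤ 1 * c := by gcongr; exact measureReal_le_one
    _ = c := one_mul c

/-- The probability of leaving the current policy. -/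
lemma measureReal_act_ne_le (h : IsRun B ε δ μ 𝓕 S) (hε : 0 < ε)
    (hδ : 0 < δ) (hδ1 : δ < 1) {n : ℕ} {G : Set Ω} (hG : MeasurableSet[𝓕 n] G)
    {U : Set X} (hU : MeasurableSet U)
    (hGU : ∀ᵐ ω ∂μ, ω ∈ G → (∃ a ∈ (S ω).explored B.Pol ε δ (n + 1),
      a ≠ (S ω).pol (n + 1) ((S ω).ctx (n + 1))) → (S ω).ctx (n + 1) ∈ U) :
    μ.real (G ∩ {ω | (S ω).act (n + 1) ≠ (S ω).pol (n + 1) ((S ω).ctx (n + 1))})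
      ≤ ε * B.ctxLaw.real U := by
  classical
  set b : Ω → Fin K := fun ω => (S ω).pol (n + 1) ((S ω).ctx (n + 1))
  -- The indicator of leaving the current policy on G. Averaged over the action it becomes 1 - p(b),
  -- at most ε and zero unless another action is explored; U is deterministic, so the law of the
  -- context finishes the bound.
  set f : Fin K → Ω → ℝ := fun c ω => if ω ∈ G ∧ c ≠ b ω then 1 else 0 with hf
  have hbm := h.measurable_greedy n
  have hset : ∀ c, MeasurableSet[preAct 𝓕 S n] {ω | ω ∈ G ∧ c ≠ b ω} := fun c => by
    have h1 : {ω | ω ∈ G ∧ c ≠ b ω} = G ∩ (b ⁻¹' {c})ᶜ := by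
      ext ω
      simp [eq_comm]
    rw [h1]
    exact (le_preAct 𝓕 S n _ hG).inter (hbm (measurableSet_singleton c)).compl
  have hfm : ∀ c, Measurable[preAct 𝓕 S n] (f c) := fun c =>
    Measurable.ite (hset c) measurable_const measurable_const
  have hfb : ∀ c ω, |f c ω| ≤ 1 := fun c ω => by
    simp only [hf]; split_ifs <;> simp
  have hact := h.condExp_act n hfm fun c => ae_of_all μ (hfb c)
  have hm1 : MeasurableSet (G ∩ {ω | (S ω).act (n + 1) ≠ b ω}) := by
    refine (𝓕.le n _ hG).inter (MeasurableSet.compl ?_)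
    exact measurableSet_eq_fun ((h.act_meas n).mono (𝓕.le _) le_rfl)
      (hbm.mono (h.preAct_le n) le_rfl)
  have e1 : μ.real (G ∩ {ω | (S ω).act (n + 1) ≠ b ω})
      = ∫ ω, f ((S ω).act (n + 1)) ω ∂μ := by
    have : (fun ω => f ((S ω).act (n + 1)) ω)
        = (G ∩ {ω | (S ω).act (n + 1) ≠ b ω}).indicator fun _ => (1 : ℝ) := by
      ext ω
      simp [hf, Set.indicator_apply]
    rw [this, integral_indicator_const _ hm1, smul_eq_mul, mul_one]
  have hmU : Measurable fun z : X × (Fin K → ℝ) => U.indicator (fun _ => (1 : ℝ)) z.1 :=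
    (measurable_const.indicator hU).comp measurable_fst
  rw [e1, ← integral_condExp (h.preAct_le n)]
  calc ∫ ω, (μ[fun ω => f ((S ω).act (n + 1)) ω | preAct 𝓕 S n]) ω ∂μ
      ≤ ∫ ω, ε * U.indicator (fun _ => (1 : ℝ)) (sample S n ω).1 ∂μ := by
        refine integral_mono_ae integrable_condExp ?_ ?_
        · refine Integrable.of_bound ((hmU.comp
            (h.measurable_sample n)).const_mul ε).aestronglyMeasurable ε (ae_of_all _ fun ω => ?_)
          by_cases hx : (sample S n ω).1 ∈ U <;> simp [hx, hε.le, abs_of_pos hε]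
        · filter_upwards [hact, hGU] with ω h1 h2
          rw [h1]
          have hmem := pol_mem_explored hε hδ hδ1 (h.pol_oracle n ω)
          by_cases hω : ω ∈ G
          · have h3 : ∑ c, (S ω).prob B.Pol ε δ (n + 1) c * f c ω
                = 1 - playProb ε ((S ω).explored B.Pol ε δ (n + 1)) (b ω) (b ω) := by
              have h4 := sum_playProb (ε := ε) hmem
              have h5 : ∀ c, (S ω).prob B.Pol ε δ (n + 1) c * f c ω
                  = playProb ε ((S ω).explored B.Pol ε δ (n + 1)) (b ω) c
                    - if c = b ω then
                      playProb ε ((S ω).explored B.Pol ε δ (n + 1)) (b ω) c else 0 := by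
                intro c
                by_cases hc : c = b ω <;> simp [hf, hω, hc, Transcript.prob, b]
              simp_rw [h5]
              rw [Finset.sum_sub_distrib, h4]
              simp
            rw [h3]
            refine (one_sub_playProb_self_le hε _ hmem).trans ?_
            split_ifs with h6
            · have : (sample S n ω).1 ∈ U := h2 hω h6
              simp [this]
            · exact mul_nonneg hε.le (Set.indicator_nonneg (fun _ _ => zero_le_one) _)
          · have h3 : ∑ c, (S ω).prob B.Pol ε δ (n + 1) c * f c ω = 0 := by
              simp [hf, hω]
            rw [h3]
            exact mul_nonneg hε.le (Set.indicator_nonneg (fun _ _ => zero_le_one) _)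
    _ = ε * B.ctxLaw.real U := by
        rw [integral_const_mul, h.integral_sample n hmU]
        congr 1
        have : (fun z : X × (Fin K → ℝ) => U.indicator (fun _ => (1 : ℝ)) z.1)
            = (Prod.fst ⁻¹' U).indicator fun _ => (1 : ℝ) := by
          ext z; simp [Set.indicator_apply]
        rw [this, integral_indicator_const _ (measurable_fst hU), smul_eq_mul, mul_one,
          Problem.ctxLaw, map_measureReal_apply measurable_fst hU]

/-- The regret of a round on an event, split into exploration, estimation and failure. -/
lemma setIntegral_roundRegret_le (h : IsRun B ε δ μ 𝓕 S) {n : ℕ} {E G : Set Ω} (hEG : E ⊆ G)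
    (hE : MeasurableSet E) (hG : MeasurableSet[𝓕 n] G) :
    ∫ ω in E, roundRegret B (S ω) n ∂μ
      ≤ μ.real (G ∩ {ω | (S ω).act (n + 1) ≠ (S ω).pol (n + 1) ((S ω).ctx (n + 1))})
        + ∫ ω in G, B.excess ((S ω).pol (n + 1)) (sample S n ω) ∂μ + μ.real (G \ E) := by
  classical
  set D : Ω → ℝ := fun ω => B.excess ((S ω).pol (n + 1)) (sample S n ω) with hD
  set V : Set Ω := {ω | (S ω).act (n + 1) ≠ (S ω).pol (n + 1) ((S ω).ctx (n + 1))}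
  have hV : MeasurableSet V :=
    (measurableSet_eq_fun ((h.act_meas n).mono (𝓕.le _) le_rfl)
      ((h.measurable_greedy n).mono (h.preAct_le n) le_rfl)).compl
  have hG' := 𝓕.le n _ hG
  have hDi := h.integrable_excess_pol n
  have hVi : Integrable (V.indicator fun _ => (1 : ℝ)) μ := (integrable_const 1).indicator hV
  have h1 : ∫ ω in E, roundRegret B (S ω) n ∂μ
      ≤ ∫ ω in E, (V.indicator (fun _ => (1 : ℝ)) ω + D ω) ∂μ := by
    refine integral_mono_ae (h.integrable_roundRegret n).integrableOn
      (hVi.add hDi).integrableOn (ae_restrict_of_ae ?_)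
    filter_upwards [h.ae_loss_mem] with ω hω
    simp only [hD, roundRegret, Problem.excess, sample]
    by_cases hv : ω ∈ V
    · rw [Set.indicator_of_mem hv]
      linarith [(hω n ((S ω).act (n + 1))).2,
        (hω n ((S ω).pol (n + 1) ((S ω).ctx (n + 1)))).1]
    · rw [Set.indicator_of_notMem hv]
      have : (S ω).act (n + 1) = (S ω).pol (n + 1) ((S ω).ctx (n + 1)) := not_not.1 hv
      rw [this, zero_add]
  rw [integral_add hVi.integrableOn hDi.integrableOn] at h1
  have h2 : ∫ ω in E, V.indicator (fun _ => (1 : ℝ)) ω ∂μ ≤ μ.real (G ∩ V) := by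
    rw [integral_indicator_const _ hV, smul_eq_mul, mul_one, measureReal_restrict_apply hV,
      Set.inter_comm]
    exact measureReal_mono (Set.inter_subset_inter_left _ hEG)
  -- E is not known at time n, so the integral is moved to G and the difference paid for by the
  -- trivial bound |D| ≤ 1.
  have h3 : ∫ ω in E, D ω ∂μ = ∫ ω in G, D ω ∂μ - ∫ ω in G \ E, D ω ∂μ := by
    rw [setIntegral_sdiff hE hDi.integrableOn hEG]
    ring
  have h4 : -∫ ω in G \ E, D ω ∂μ ≤ μ.real (G \ E) := by
    rw [← integral_neg]
    calc ∫ ω in G \ E, -D ω ∂μ ≤ ∫ _ω in G \ E, (1 : ℝ) ∂μ := by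
          refine integral_mono_ae hDi.neg.integrableOn (integrable_const 1)
            (ae_restrict_of_ae ?_)
          filter_upwards [h.abs_excess_pol_le n] with ω hω
          exact (neg_le_abs _).trans hω
      _ = μ.real (G \ E) := by simp
  linarith

end IsRun

end Run

/-! ### Elementary sums and cube roots. -/

section Sums

lemma sum_one_div_le (T : ℕ) (hT : 1 ≤ T) :
    ∑ n ∈ Finset.Ico 1 (T + 1), 1 / (n : ℝ) ≤ 1 + Real.log T := by
  induction T, hT using Nat.le_induction with
  | base => simp
  | succ T hT ih =>
    have hT0 : (0 : ℝ) < T := by exact_mod_cast hT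
    rw [Finset.sum_Ico_succ_top (by omega)]
    have h1 := Real.log_le_sub_one_of_pos (show 0 < (T : ℝ) / (T + 1) by positivity)
    rw [Real.log_div hT0.ne' (by positivity)] at h1
    have h2 : (T : ℝ) / (T + 1) - 1 = -(1 / (T + 1)) := by field_simp; ring
    push_cast
    linarith

lemma sum_one_div_sqrt_le (T : ℕ) :
    ∑ n ∈ Finset.Ico 1 (T + 1), 1 / Real.sqrt n ≤ 2 * Real.sqrt T := by
  induction T with
  | zero => simp
  | succ T ih =>
    rw [Finset.sum_Ico_succ_top (by omega)]
    have ha : 0 < Real.sqrt (T + 1) := Real.sqrt_pos.2 (by positivity)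
    have hb := Real.sqrt_nonneg (T : ℝ)
    have ha2 := Real.sq_sqrt (show (0 : ℝ) ≤ T + 1 by positivity)
    have hb2 := Real.sq_sqrt (show (0 : ℝ) ≤ T by positivity)
    have h1 : 1 / Real.sqrt (T + 1) ≤ 2 * Real.sqrt (T + 1) - 2 * Real.sqrt T := by
      rw [div_le_iff₀ ha]
      nlinarith [sq_nonneg (Real.sqrt (T + 1) - Real.sqrt (T : ℝ))]
    push_cast
    linarith

lemma rpow_one_third_pow {x : ℝ} (hx : 0 ≤ x) : (x ^ (1 / 3 : ℝ)) ^ 3 = x := by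
  rw [← Real.rpow_natCast, ← Real.rpow_mul hx]
  norm_num

lemma rpow_two_thirds_pow {x : ℝ} (hx : 0 ≤ x) : (x ^ (2 / 3 : ℝ)) ^ 3 = x ^ 2 := by
  rw [← Real.rpow_natCast, ← Real.rpow_mul hx, ← Real.rpow_natCast]
  norm_num

lemma sum_rpow_two_thirds_le {u : ℝ} (hu : 0 ≤ u) (T : ℕ) :
    ∑ n ∈ Finset.Ico 1 (T + 1), (u / n) ^ (2 / 3 : ℝ)
      ≤ 3 * (u ^ (2 / 3 : ℝ) * (T : ℝ) ^ (1 / 3 : ℝ)) := by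
  induction T with
  | zero => simp
  | succ T ih =>
    rw [Finset.sum_Ico_succ_top (by omega)]
    have hT1 : (0 : ℝ) < T + 1 := by positivity
    set a := ((T : ℝ) + 1) ^ (1 / 3 : ℝ) with ha
    set b := (T : ℝ) ^ (1 / 3 : ℝ) with hb
    have ha0 : 0 < a := Real.rpow_pos_of_pos hT1 _
    have hb0 : 0 ≤ b := by positivity
    have ha3 : a ^ 3 = T + 1 := rpow_one_third_pow hT1.le
    have hb3 : b ^ 3 = T := rpow_one_third_pow (by positivity)
    have hab : b ≤ a := Real.rpow_le_rpow (by positivity) (by linarith) (by norm_num)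
    have ha2 : ((T : ℝ) + 1) ^ (2 / 3 : ℝ) = a ^ 2 := by
      rw [ha, ← Real.rpow_natCast, ← Real.rpow_mul hT1.le]
      norm_num
    -- 1 = a³ - b³ = (a - b)(a² + ab + b²) ≤ 3a² (a - b).
    have h1 : 1 / a ^ 2 ≤ 3 * a - 3 * b := by
      rw [div_le_iff₀ (by positivity)]
      nlinarith [mul_nonneg (sub_nonneg.2 hab) (sub_nonneg.2 hab),
        mul_nonneg (sub_nonneg.2 hab) (mul_nonneg ha0.le (sub_nonneg.2 hab)),
        mul_nonneg (sub_nonneg.2 hab) (mul_nonneg hb0 (sub_nonneg.2 hab))]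
    have h2 : 0 ≤ u ^ (2 / 3 : ℝ) := by positivity
    push_cast
    rw [Real.div_rpow hu hT1.le, ha2]
    have h3 : u ^ (2 / 3 : ℝ) / a ^ 2 = u ^ (2 / 3 : ℝ) * (1 / a ^ 2) := by ring
    rw [h3]
    nlinarith [mul_le_mul_of_nonneg_left h1 h2]

lemma min_one_le_rpow {x : ℝ} (hx : 0 ≤ x) : min 1 x ≤ x ^ (2 / 3 : ℝ) := by
  rcases le_total 1 x with h | h
  · rw [min_eq_left h]
    exact Real.one_le_rpow h (by norm_num)
  · rw [min_eq_right h]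
    exact Real.self_le_rpow_of_le_one hx h (by norm_num)

end Sums

/-! ### Summing the regret over the rounds. -/

section Regret

variable {X : Type*} [MeasurableSpace X] {K : ℕ} {Ω : Type*} [mΩ : MeasurableSpace Ω]
  {B : Problem X K} {ε δ : ℝ} {μ : Measure Ω} [IsProbabilityMeasure μ]
  {𝓕 : Filtration ℕ mΩ} {S : Ω → Transcript X K}

namespace IsRun

/-- Expected regret of round `n + 1` on the good event, under the Massart condition. -/
lemma setIntegral_roundRegret_le_of_massart (h : IsRun B ε δ μ 𝓕 S) (hε : 0 < ε) (hε1 : ε ≤ 1)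
    (hδ : 0 < δ) (hδ1 : δ < 1) {τ : ℝ} (hτ : B.Massart τ) (hτ1 : τ ≤ 1) {n : ℕ} (hn : 1 ≤ n) :
    ∫ ω in goodEvent B ε δ S, roundRegret B (S ω) n ∂μ
      ≤ 20 / τ * min 1 (K * eT B.Pol.card δ n / ε)
        + 14 * (B.disCoeff / τ) * Real.sqrt (ε * K * eT B.Pol.card δ n) := by
  have hτ0 := hτ.1
  have hn0 : (1 : ℝ) ≤ n := by exact_mod_cast hn
  have hK0 : (1 : ℝ) ≤ K := by exact_mod_cast B.one_le_K
  have he := two_div_le_eT B.one_le_card hδ hδ1 hn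
  have he0 : 0 < eT B.Pol.card δ n := (by positivity : (0 : ℝ) < 2 / n).trans_le he
  have hθ := B.disCoeff_nonneg
  set e := eT B.Pol.card δ n
  set q : ℝ := K * e / ε with hq
  have hq0 : 0 < q := by positivity
  have heq : e ≤ q := by
    rw [hq, le_div_iff₀ hε]
    nlinarith
  set w := min 1 q with hw
  have hw0 : 0 ≤ w := le_min zero_le_one hq0.le
  have hτi : 1 ≤ 1 / τ := by rw [le_div_iff₀ hτ0]; linarith
  have hG := h.measurableSet_goodUpTo n
  have hsplit := h.setIntegral_roundRegret_le (goodEvent_subset_goodUpTo n)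
    h.measurableSet_goodEvent hG
  -- The failure probability is at most 2δ/(n+1) ≤ 2/n ≤ e_n ≤ q.
  have hfail : μ.real (goodUpTo B ε δ S n \ goodEvent B ε δ S) ≤ w := by
    refine (h.measureReal_goodUpTo_diff_le hε hε1 hδ hδ1 n).trans (le_min ?_ ?_)
    · push_cast
      rw [← mul_div_assoc, div_le_one (by positivity)]
      linarith
    · refine le_trans ?_ (he.trans heq)
      push_cast
      rw [← mul_div_assoc]
      exact div_le_div₀ (by norm_num) (by linarith) (by linarith) (by linarith)
  have hest : ∫ ω in goodUpTo B ε δ S n, B.excess ((S ω).pol (n + 1)) (sample S n ω) ∂μ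
      ≤ 17 / τ * w := by
    refine h.setIntegral_excess_pol_le hG (by positivity) ?_
    filter_upwards [h.ae_loss_mem] with ω hω hωG
    have h1 := risk_pol_sub_le hε hε1 hδ hδ1 hτ hτ1 (fun t => h.pol_oracle t ω) hω hn hωG
    have h2 := (Problem.risk_sub_le_rho (h.pol_oracle n ω).1).trans (B.rho_le_one _ _)
    rw [hw, mul_min_of_nonneg _ _ (by positivity)]
    refine le_min (h2.trans ?_) h1
    rw [mul_one, le_div_iff₀ hτ0]
    linarith
  have hexp : μ.real (goodUpTo B ε δ S n ∩
      {ω | (S ω).act (n + 1) ≠ (S ω).pol (n + 1) ((S ω).ctx (n + 1))})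
      ≤ w + 14 * (B.disCoeff / τ) * Real.sqrt (ε * K * e) := by
    -- The disagreement estimate needs q ≤ 1; otherwise w = 1 and the trivial bound suffices.
    rcases le_total q 1 with hq1 | hq1
    · have h1 := h.measureReal_act_ne_le hε hδ hδ1 hG
        (B.measurableSet_disRegion (14 / τ * Real.sqrt q)) (by
          filter_upwards [h.ae_loss_mem] with ω hω hωG ha
          exact ctx_mem_disRegion hε hε1 hδ hδ1 hτ (fun t => h.pol_oracle t ω) hω hn hωG hq1 ha)
      have h2 := B.measureReal_disRegion_le_disCoeff
        (show 0 < 14 / τ * Real.sqrt q by have := Real.sqrt_pos.2 hq0; positivity)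
      have h3 : ε * Real.sqrt q = Real.sqrt (ε * K * e) := by
        have : ε * K * e = ε ^ 2 * q := by rw [hq]; field_simp
        rw [this, Real.sqrt_mul (by positivity), Real.sqrt_sq hε.le]
      calc _ ≤ ε * (B.disCoeff * (14 / τ * Real.sqrt q)) :=
            h1.trans (mul_le_mul_of_nonneg_left h2 hε.le)
        _ = 14 * (B.disCoeff / τ) * (ε * Real.sqrt q) := by ring
        _ ≤ _ := by rw [h3]; linarith
    · have h1 := h.measureReal_act_ne_le hε hδ hδ1 hG MeasurableSet.univ
        (ae_of_all _ fun ω _ _ => Set.mem_univ _)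
      have h2 : ε * B.ctxLaw.real Set.univ ≤ 1 := by simp [hε1]
      have h3 : w = 1 := min_eq_left hq1
      have h4 : 0 ≤ 14 * (B.disCoeff / τ) * Real.sqrt (ε * K * e) := by positivity
      linarith
  have h20 : 20 / τ * w = 17 / τ * w + 3 * (1 / τ * w) := by ring
  have hw1 : w ≤ 1 / τ * w := le_mul_of_one_le_left hw0 hτi
  linarith

lemma integral_regret_cond (h : IsRun B ε δ μ 𝓕 S) (T : ℕ) :
    ∫ ω, (S ω).regret B.opt T ∂μ[|goodEvent B ε δ S] = (μ.real (goodEvent B ε δ S))⁻¹ *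
      ∑ n ∈ Finset.range T, ∫ ω in goodEvent B ε δ S, roundRegret B (S ω) n ∂μ := by
  simp_rw [regret_eq_sum]
  rw [ProbabilityTheory.cond, integral_smul_measure, smul_eq_mul, ENNReal.toReal_inv,
    integral_finsetSum _ fun n _ => (h.integrable_roundRegret n).integrableOn]
  rfl

/-- If all policies agree with the optimal one, there is no regret. -/
lemma integral_regret_cond_of_rho_eq_zero (h : IsRun B ε δ μ 𝓕 S) (hε : 0 < ε)
    (hδ : 0 < δ) (hδ1 : δ < 1) (hρ : ∀ π ∈ B.Pol, B.rho π B.opt = 0) (T : ℕ) :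
    ∫ ω, (S ω).regret B.opt T ∂μ[|goodEvent B ε δ S] = 0 := by
  rw [h.integral_regret_cond, Finset.sum_eq_zero, mul_zero]
  intro n _
  have hx : ∀ᵐ ω ∂μ, (S ω).ctx (n + 1) ∉ B.disRegion 1 := by
    refine h.ae_sample n (p := fun z => z.1 ∉ B.disRegion 1) ?_
    have h1 := B.measureReal_disRegion_eq_zero hρ 1
    rw [Problem.ctxLaw, map_measureReal_apply measurable_fst (B.measurableSet_disRegion 1),
      measureReal_eq_zero_iff] at h1
    exact measure_eq_zero_iff_ae_notMem.1 h1
  have hact : ∀ᵐ ω ∂μ, (S ω).act (n + 1) = (S ω).pol (n + 1) ((S ω).ctx (n + 1)) := by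
    have h1 := h.measureReal_act_ne_le (n := n) hε hδ hδ1 (G := Set.univ) MeasurableSet.univ
      (B.measurableSet_disRegion 1) (ae_of_all _ fun ω _ => by
        rintro ⟨a, ha, hne⟩
        obtain ⟨π, hπ, hπa, -⟩ := (mem_explored_iff (h.pol_oracle n ω)).1 ha
        by_cases hao : a = B.opt ((S ω).ctx (n + 1))
        · exact ⟨_, (h.pol_oracle n ω).1, B.rho_le_one _ _, by rw [← hao]; exact hne.symm⟩
        · exact ⟨π, hπ, B.rho_le_one _ _, by rwa [hπa]⟩)
    rw [B.measureReal_disRegion_eq_zero hρ, mul_zero, Set.univ_inter] at h1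
    have h2 := le_antisymm h1 measureReal_nonneg
    rw [measureReal_eq_zero_iff] at h2
    filter_upwards [measure_eq_zero_iff_ae_notMem.1 h2] with ω hω
    exact not_not.1 hω
  refine integral_eq_zero_of_ae (ae_restrict_of_ae ?_)
  filter_upwards [hx, hact] with ω h1 h2
  have h3 : (S ω).pol (n + 1) ((S ω).ctx (n + 1)) = B.opt ((S ω).ctx (n + 1)) := by
    by_contra hne
    exact h1 ⟨_, (h.pol_oracle n ω).1, B.rho_le_one _ _, hne⟩
  simp [roundRegret, h2, h3]

/-- The regret bound before the summation of the leading term. -/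
lemma integral_regret_cond_le (h : IsRun B ε δ μ 𝓕 S) (hε : 0 < ε) (hε1 : ε ≤ 1)
    (hδ : 0 < δ) (hδ1 : δ < 1) {τ : ℝ} (hτ : B.Massart τ) (hτ1 : τ ≤ 1) {T : ℕ} (hT : 1 ≤ T) :
    ∫ ω, (S ω).regret B.opt T ∂μ[|goodEvent B ε δ S]
      ≤ 2 * (1 + 20 / τ * ∑ n ∈ Finset.Ico 1 T,
          min 1 (6 * (K * Real.log (T * B.Pol.card / δ) / ε) / n)
        + 84 * (B.disCoeff / τ *
          Real.sqrt (ε * K * T * Real.log (T * B.Pol.card / δ)))) := by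
  have hτ0 := hτ.1
  have hθ := B.disCoeff_nonneg
  have hT0 : (1 : ℝ) ≤ T := by exact_mod_cast hT
  have hN0 : (1 : ℝ) ≤ B.Pol.card := by exact_mod_cast B.one_le_card
  set L := Real.log (T * B.Pol.card / δ) with hL
  have hL0 : 0 ≤ L := by
    refine Real.log_nonneg ?_
    rw [le_div_iff₀ hδ]
    nlinarith
  set U := 1 + 20 / τ * ∑ n ∈ Finset.Ico 1 T, min 1 (6 * (K * L / ε) / n)
    + 84 * (B.disCoeff / τ * Real.sqrt (ε * K * T * L)) with hU
  have hU0 : 0 ≤ U := by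
    have : 0 ≤ ∑ n ∈ Finset.Ico 1 T, min 1 (6 * (K * L / ε) / (n : ℝ)) :=
      Finset.sum_nonneg fun n _ => le_min zero_le_one (by positivity)
    positivity
  have hsum : ∑ n ∈ Finset.range T, ∫ ω in goodEvent B ε δ S, roundRegret B (S ω) n ∂μ ≤ U := by
    rw [Finset.range_eq_Ico, Finset.sum_eq_sum_Ico_succ_bot (by omega), zero_add, hU, add_assoc]
    refine add_le_add ?_ ?_
    -- The first round has no data and costs at most 1.
    · calc ∫ ω in goodEvent B ε δ S, roundRegret B (S ω) 0 ∂μ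
          ≤ ∫ _ω in goodEvent B ε δ S, (1 : ℝ) ∂μ := by
            refine integral_mono_ae (h.integrable_roundRegret 0).integrableOn
              (integrable_const 1) (ae_restrict_of_ae ?_)
            filter_upwards [h.abs_roundRegret_le 0] with ω hω
            exact (le_abs_self _).trans hω
        _ = μ.real (goodEvent B ε δ S) := by simp
        _ ≤ 1 := measureReal_le_one
    · have hterm : ∀ n ∈ Finset.Ico 1 T, ∫ ω in goodEvent B ε δ S, roundRegret B (S ω) n ∂μ
          ≤ 20 / τ * min 1 (6 * (K * L / ε) / n)
            + 42 * (B.disCoeff / τ) * Real.sqrt (ε * K * L) * (1 / Real.sqrt n) := by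
        intro n hn
        obtain ⟨hn1, hnT⟩ := Finset.mem_Ico.1 hn
        have hn0 : (0 : ℝ) < n := by exact_mod_cast hn1
        have he := eT_le B.one_le_card hδ hδ1 hn1 hnT
        rw [← hL] at he
        refine (h.setIntegral_roundRegret_le_of_massart hε hε1 hδ hδ1 hτ hτ1 hn1).trans ?_
        refine add_le_add ?_ ?_
        · gcongr 20 / τ * min 1 ?_
          calc K * eT B.Pol.card δ n / ε ≤ K * (6 * L / n) / ε := by gcongr
            _ = 6 * (K * L / ε) / n := by ring
        -- √6 ≤ 3 here and Σ 1/√n ≤ 2√T below give 14 · 3 · 2 = 84.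
        · have h1 : Real.sqrt (ε * K * eT B.Pol.card δ n)
              ≤ 3 * (Real.sqrt (ε * K * L) * (1 / Real.sqrt n)) := by
            calc Real.sqrt (ε * K * eT B.Pol.card δ n)
                ≤ Real.sqrt (3 ^ 2 * (ε * K * L / n)) := by
                  apply Real.sqrt_le_sqrt
                  calc ε * K * eT B.Pol.card δ n ≤ ε * K * (6 * L / n) := by gcongr
                    _ = 6 * (ε * K * L / n) := by ring
                    _ ≤ 3 ^ 2 * (ε * K * L / n) := by gcongr; norm_num
              _ = 3 * (Real.sqrt (ε * K * L) * (1 / Real.sqrt n)) := by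
                  rw [Real.sqrt_mul (by positivity) (ε * K * L / n), Real.sqrt_sq (by norm_num),
                    Real.sqrt_div (by positivity)]
                  ring
          calc _ ≤ 14 * (B.disCoeff / τ) * (3 * (Real.sqrt (ε * K * L) * (1 / Real.sqrt n))) := by
                gcongr
            _ = _ := by ring
      refine (Finset.sum_le_sum hterm).trans ?_
      rw [Finset.sum_add_distrib, ← Finset.mul_sum, ← Finset.mul_sum]
      refine add_le_add le_rfl ?_
      have h2 : ∑ n ∈ Finset.Ico 1 T, 1 / Real.sqrt n ≤ 2 * Real.sqrt T := by
        refine (Finset.sum_le_sum_of_subset_of_nonneg (Finset.Ico_subset_Ico_right T.le_succ)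
          fun n _ _ => by positivity).trans (sum_one_div_sqrt_le T)
      calc _ ≤ 42 * (B.disCoeff / τ) * Real.sqrt (ε * K * L) * (2 * Real.sqrt T) :=
            mul_le_mul_of_nonneg_left h2 (by positivity)
        _ = 84 * (B.disCoeff / τ * (Real.sqrt (ε * K * L) * Real.sqrt T)) := by ring
        _ = _ := by
          rw [← Real.sqrt_mul (by positivity)]
          have : ε * K * L * T = ε * K * T * L := by ring
          rw [this]
  have hP := h.measureReal_goodEvent_ge hε hε1 hδ hδ1
  -- The bound 1 - δ/2 makes the cost of conditioning at most 2 for every δ < 1.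
  have hP2 : 1 / 2 ≤ μ.real (goodEvent B ε δ S) := by linarith
  rw [h.integral_regret_cond]
  calc _ ≤ (μ.real (goodEvent B ε δ S))⁻¹ * U :=
        mul_le_mul_of_nonneg_left hsum (inv_nonneg.2 measureReal_nonneg)
    _ ≤ 2 * U := by
        refine mul_le_mul_of_nonneg_right ?_ hU0
        rw [inv_le_comm₀ (by linarith) (by norm_num)]
        linarith

end IsRun

end Regret

/-! ### Choice of the exploration parameter. -/

lemma log_two_gt : (0.69 : ℝ) < Real.log 2 := by linarith [Real.log_two_gt_d9]

lemma log_two_le_log_div {T N : ℕ} (hT : 2 ≤ T) (hN : 1 ≤ N) {δ : ℝ} (hδ : 0 < δ) (hδ1 : δ < 1) :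
    Real.log 2 ≤ Real.log (T * N / δ) := by
  have hT0 : (2 : ℝ) ≤ T := by exact_mod_cast hT
  have hN0 : (1 : ℝ) ≤ N := by exact_mod_cast hN
  refine Real.log_le_log (by norm_num) ?_
  rw [le_div_iff₀ hδ]
  nlinarith

/-- The exploration parameter which balances the two terms of the regret bound. -/
def balancedParam (K N T : ℕ) (δ θ : ℝ) : ℝ :=
  (K * Real.log (T * N / δ) * Real.log T ^ 2 / (θ ^ 2 * T)) ^ (1 / 3 : ℝ)

open Classical in
/-- The tuned exploration parameter. -/
def tunedParam (K N T : ℕ) (δ θ : ℝ) : ℝ :=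
  if 0 < balancedParam K N T δ θ ∧ balancedParam K N T δ θ ≤ 1 then balancedParam K N T δ θ else 1

lemma tunedParam_pos (K N T : ℕ) (δ θ : ℝ) : 0 < tunedParam K N T δ θ := by
  unfold tunedParam
  split_ifs with h
  · exact h.1
  · exact one_pos

lemma tunedParam_le_one (K N T : ℕ) (δ θ : ℝ) : tunedParam K N T δ θ ≤ 1 := by
  unfold tunedParam
  split_ifs with h
  · exact h.2
  · exact le_rfl

section Tuning

variable {a θ t l : ℝ}

lemma rate_pow (ha : 0 < a) (hθ : 1 ≤ θ) (ht : 0 < t) (hl : 0 < l) :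
    ((θ * a) ^ (2 / 3 : ℝ) * (t * l) ^ (1 / 3 : ℝ)) ^ 3 = (θ * a) ^ 2 * (t * l) := by
  have : 0 < θ := by linarith
  rw [mul_pow, rpow_two_thirds_pow (by positivity), rpow_one_third_pow (by positivity)]

/-- Cubing both sides leaves a rational identity; with a = K log(TN/δ) the left side is the
estimation term without 1/τ. -/
lemma balanced_fst (ha : 0 < a) (hθ : 1 ≤ θ) (ht : 0 < t) (hl : 0 < l) {ε : ℝ} (hε : 0 < ε)
    (h : ε ^ 3 = a * l ^ 2 / (θ ^ 2 * t)) :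
    a * l / ε = (θ * a) ^ (2 / 3 : ℝ) * (t * l) ^ (1 / 3 : ℝ) := by
  have hθ0 : 0 < θ := by linarith
  rw [← pow_left_inj₀ (by positivity) (by positivity) (by norm_num : 3 ≠ 0),
    rate_pow ha hθ ht hl, div_pow, h]
  field_simp

/-- The sixth power clears both the square root and the cube roots. An inequality on ε³ suffices, so
the truncated choice ε = 1 is covered too. -/
lemma balanced_snd_le (ha : 0 < a) (hθ : 1 ≤ θ) (ht : 0 < t) (hl : 0 < l) {ε : ℝ} (hε : 0 < ε)
    (h : ε ^ 3 ≤ a * l ^ 2 / (θ ^ 2 * t)) :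
    θ * Real.sqrt (ε * a * t) ≤ (θ * a) ^ (2 / 3 : ℝ) * (t * l) ^ (1 / 3 : ℝ) := by
  have hθ0 : 0 < θ := by linarith
  rw [← pow_le_pow_iff_left₀ (by positivity) (by positivity) (by norm_num : 6 ≠ 0)]
  have h1 : (θ * Real.sqrt (ε * a * t)) ^ 6 = θ ^ 6 * (ε ^ 3 * (a * t) ^ 3) := by
    have h2 : Real.sqrt (ε * a * t) ^ 6 = (Real.sqrt (ε * a * t) ^ 2) ^ 3 := by ring
    rw [mul_pow, h2, Real.sq_sqrt (by positivity)]
    ring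
  have h3 : ((θ * a) ^ (2 / 3 : ℝ) * (t * l) ^ (1 / 3 : ℝ)) ^ 6
      = ((θ * a) ^ 2 * (t * l)) ^ 2 := by
    rw [← rate_pow ha hθ ht hl]
    ring
  rw [h1, h3]
  calc θ ^ 6 * (ε ^ 3 * (a * t) ^ 3) ≤ θ ^ 6 * (a * l ^ 2 / (θ ^ 2 * t) * (a * t) ^ 3) := by
        gcongr
    _ = ((θ * a) ^ 2 * (t * l)) ^ 2 := by field_simp

lemma one_le_two_mul_rate (ha : 0.69 ≤ a) (hθ : 1 ≤ θ) (ht : 2 ≤ t) (hl : 0.69 ≤ l) :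
    1 ≤ 2 * ((θ * a) ^ (2 / 3 : ℝ) * (t * l) ^ (1 / 3 : ℝ)) := by
  have ha0 : 0 < a := by linarith
  have hl0 : 0 < l := by linarith
  rw [← pow_le_pow_iff_left₀ (by norm_num) (by positivity) (by norm_num : 3 ≠ 0), mul_pow,
    rate_pow ha0 hθ (by linarith) hl0]
  have h1 : 0.69 ≤ θ * a := by nlinarith
  have h2 : 1.38 ≤ t * l := by nlinarith
  have h3 : 0.69 ^ 2 ≤ (θ * a) ^ 2 := by gcongr
  nlinarith

lemma six_mul_rpow_le (ha : 0 < a) (hθ : 1 ≤ θ) (ht : 0 < t) (hl : 0.69 ≤ l) :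
    (6 * a) ^ (2 / 3 : ℝ) * t ^ (1 / 3 : ℝ)
      ≤ 4 * ((θ * a) ^ (2 / 3 : ℝ) * (t * l) ^ (1 / 3 : ℝ)) := by
  have hl0 : 0 < l := by linarith
  rw [← pow_le_pow_iff_left₀ (by positivity) (by positivity) (by norm_num : 3 ≠ 0), mul_pow 4,
    rate_pow ha hθ ht hl0, mul_pow, rpow_two_thirds_pow (by positivity), rpow_one_third_pow ht.le]
  have h1 : a ^ 2 ≤ (θ * a) ^ 2 := by
    gcongr
    nlinarith
  calc (6 * a) ^ 2 * t = 36 * (a ^ 2 * t) := by ring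
    _ ≤ 4 ^ 3 * l * (a ^ 2 * t) := by gcongr; linarith
    _ = 4 ^ 3 * (a ^ 2 * (t * l)) := by ring
    _ ≤ 4 ^ 3 * ((θ * a) ^ 2 * (t * l)) := by gcongr

end Tuning

/-! ### The two regret bounds. -/

section Final

variable {X : Type*} [MeasurableSpace X] {K : ℕ} {Ω : Type*} [mΩ : MeasurableSpace Ω]
  {B : Problem X K} {ε δ : ℝ} {μ : Measure Ω} [IsProbabilityMeasure μ]
  {𝓕 : Filtration ℕ mΩ} {S : Ω → Transcript X K}

namespace IsRun

/-- The regret bound for a general exploration parameter. -/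
theorem integral_regret_cond_le_of_massart (h : IsRun B ε δ μ 𝓕 S) (hε : 0 < ε) (hε1 : ε ≤ 1)
    (hδ : 0 < δ) (hδ1 : δ < 1) {τ : ℝ} (hτ : B.Massart τ) {T : ℕ} (hT : 2 ≤ T) :
    ∫ ω, (S ω).regret B.opt T ∂μ[|goodEvent B ε δ S]
      ≤ 726 * (K * Real.log (T * B.Pol.card / δ) / (τ * ε) * Real.log T
        + B.disCoeff / τ * Real.sqrt (ε * K * T * Real.log (T * B.Pol.card / δ))) := by
  have hτ0 := hτ.1
  have hθ := B.disCoeff_nonneg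
  have hT0 : (2 : ℝ) ≤ T := by exact_mod_cast hT
  have hK0 : (1 : ℝ) ≤ K := by exact_mod_cast B.one_le_K
  have hL := log_two_gt.le.trans (log_two_le_log_div hT B.one_le_card hδ hδ1)
  have hl : 0.69 ≤ Real.log T := log_two_gt.le.trans (Real.log_le_log (by norm_num) hT0)
  set L := Real.log (T * B.Pol.card / δ)
  set l := Real.log T with hl_def
  have hA0 : 0 ≤ K * L / (τ * ε) * l := by positivity
  have hB0 : 0 ≤ B.disCoeff / τ * Real.sqrt (ε * K * T * L) := by positivity
  -- In the degenerate case τ may exceed 1 and the regret is exactly 0; otherwise τ ≤ 1.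
  by_cases hρ : ∀ π ∈ B.Pol, B.rho π B.opt = 0
  · rw [h.integral_regret_cond_of_rho_eq_zero hε hδ hδ1 hρ]
    positivity
  · push Not at hρ
    obtain ⟨π, hπ, hρ⟩ := hρ
    have hτ1 := hτ.le_one hπ (lt_of_le_of_ne (B.rho_nonneg _ _) hρ.symm)
    refine (h.integral_regret_cond_le hε hε1 hδ hδ1 hτ hτ1 (by omega)).trans ?_
    have h1 : ∑ n ∈ Finset.Ico 1 T, min 1 (6 * (K * L / ε) / (n : ℝ))
        ≤ 18 * (K * L / ε * l) := by
      have h2 : ∑ n ∈ Finset.Ico 1 T, 1 / (n : ℝ) ≤ 1 + l := by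
        refine (Finset.sum_le_sum_of_subset_of_nonneg (Finset.Ico_subset_Ico_right T.le_succ)
          fun n _ _ => by positivity).trans (sum_one_div_le T (by omega))
      calc _ ≤ ∑ n ∈ Finset.Ico 1 T, 6 * (K * L / ε) * (1 / (n : ℝ)) :=
            Finset.sum_le_sum fun n _ => (min_le_right _ _).trans (le_of_eq (by ring))
        _ = 6 * (K * L / ε) * ∑ n ∈ Finset.Ico 1 T, 1 / (n : ℝ) := by rw [Finset.mul_sum]
        _ ≤ 6 * (K * L / ε) * (3 * l) := by gcongr; linarith
        _ = _ := by ring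
    have h3 : 20 / τ * (18 * (K * L / ε * l)) = 360 * (K * L / (τ * ε) * l) := by
      field_simp; norm_num
    -- The cost of the first round is absorbed since 0.69² > 1/3; the total is 2 (3 + 360) = 726.
    have h4 : 1 ≤ 3 * (K * L / (τ * ε) * l) := by
      have h5 : 0.69 ≤ K * L / (τ * ε) := by
        rw [le_div_iff₀ (by positivity)]
        have : τ * ε ≤ 1 := mul_le_one₀ hτ1 hε.le hε1
        nlinarith
      nlinarith
    have h6 := mul_le_mul_of_nonneg_left h1 (show 0 ≤ 20 / τ by positivity)
    rw [h3] at h6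
    linarith

/-- The regret bound for the tuned exploration parameter. -/
theorem integral_regret_cond_le_of_tuned
    (hδ : 0 < δ) (hδ1 : δ < 1) {τ : ℝ} (hτ : B.Massart τ) {T : ℕ} (hT : 2 ≤ T)
    (hε : ε = tunedParam K B.Pol.card T δ B.disCoeff) (h : IsRun B ε δ μ 𝓕 S) :
    ∫ ω, (S ω).regret B.opt T ∂μ[|goodEvent B ε δ S]
      ≤ 1452 * (1 / τ * (B.disCoeff * K * Real.log (T * B.Pol.card / δ)) ^ (2 / 3 : ℝ)
        * (T * Real.log T) ^ (1 / 3 : ℝ)) := by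
  have hτ0 := hτ.1
  have hθ := B.disCoeff_nonneg
  have hε0 : 0 < ε := hε ▸ tunedParam_pos _ _ _ _ _
  have hε1 : ε ≤ 1 := hε ▸ tunedParam_le_one _ _ _ _ _
  have hT0 : (2 : ℝ) ≤ T := by exact_mod_cast hT
  have hK0 : (1 : ℝ) ≤ K := by exact_mod_cast B.one_le_K
  have hL := log_two_gt.le.trans (log_two_le_log_div hT B.one_le_card hδ hδ1)
  have hl : 0.69 ≤ Real.log T := log_two_gt.le.trans (Real.log_le_log (by norm_num) hT0)
  by_cases hρ : ∀ π ∈ B.Pol, B.rho π B.opt = 0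
  · rw [h.integral_regret_cond_of_rho_eq_zero hε0 hδ hδ1 hρ]
    positivity
  · push Not at hρ
    obtain ⟨π, hπ, hρ⟩ := hρ
    have hρ0 := lt_of_le_of_ne (B.rho_nonneg _ _) hρ.symm
    have hτ1 := hτ.le_one hπ hρ0
    have hθ1 := B.one_le_disCoeff hπ hρ0
    have hmain := h.integral_regret_cond_le_of_massart hε0 hε1 hδ hδ1 hτ hT
    have hmain' := h.integral_regret_cond_le hε0 hε1 hδ hδ1 hτ hτ1 (by omega : 1 ≤ T)
    unfold tunedParam balancedParam at hε
    set L := Real.log (T * B.Pol.card / δ)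
    set l := Real.log T
    set θ := B.disCoeff
    set a := K * L with ha
    have ha1 : 0.69 ≤ a := by nlinarith
    have ha0 : 0 < a := by linarith
    have hl0 : 0 < l := by linarith
    have ht0 : (0 : ℝ) < T := by linarith
    set P := (θ * a) ^ (2 / 3 : ℝ) * ((T : ℝ) * l) ^ (1 / 3 : ℝ) with hP
    have hgoal : 1 / τ * (θ * K * L) ^ (2 / 3 : ℝ) * (T * l) ^ (1 / 3 : ℝ) = 1 / τ * P := by
      rw [hP, mul_assoc θ, mul_assoc]
    rw [hgoal]
    have hsq : ε * K * T * L = ε * a * T := by rw [ha]; ring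
    rw [hsq] at hmain hmain'
    have hx0 : 0 < a * l ^ 2 / (θ ^ 2 * T) := by
      have : 0 < θ := by linarith
      positivity
    have hP0 : 0 ≤ P := by positivity
    split_ifs at hε with hcase
    -- Balanced case: both terms are at most P/τ, giving 2 · 726 = 1452.
    · have hε3 : ε ^ 3 = a * l ^ 2 / (θ ^ 2 * T) := by
        rw [hε, rpow_one_third_pow hx0.le]
      have h1 := balanced_fst ha0 hθ1 ht0 hl0 hε0 hε3
      have h2 := balanced_snd_le ha0 hθ1 ht0 hl0 hε0 hε3.le
      have h3 : a / (τ * ε) * l = 1 / τ * P := by rw [hP, ← h1]; field_simp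
      have h4 : θ / τ * Real.sqrt (ε * a * T) ≤ 1 / τ * P := by
        calc θ / τ * Real.sqrt (ε * a * T) = 1 / τ * (θ * Real.sqrt (ε * a * T)) := by ring
          _ ≤ 1 / τ * P := by gcongr
      rw [h3] at hmain
      linarith
    -- Here θ ≥ 1 makes the balanced value positive, so it was rejected for exceeding 1.
    · have hgt : 1 < (a * l ^ 2 / (θ ^ 2 * T)) ^ (1 / 3 : ℝ) := by
        by_contra hle
        exact hcase ⟨Real.rpow_pos_of_pos hx0 _, not_lt.1 hle⟩
      have hε3 : ε ^ 3 ≤ a * l ^ 2 / (θ ^ 2 * T) := by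
        rw [hε, ← rpow_one_third_pow hx0.le]
        gcongr
      have h2 := balanced_snd_le ha0 hθ1 ht0 hl0 hε0 hε3
      have h4 : θ / τ * Real.sqrt (ε * a * T) ≤ 1 / τ * P := by
        calc θ / τ * Real.sqrt (ε * a * T) = 1 / τ * (θ * Real.sqrt (ε * a * T)) := by ring
          _ ≤ 1 / τ * P := by gcongr
      -- At ε = 1 the logarithmic bound a l would exceed P, so the truncation at 1 has to be
      -- exploited.
      have h5 : ∑ n ∈ Finset.Ico 1 T, min 1 (6 * (a / ε) / (n : ℝ)) ≤ 12 * P := by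
        calc _ ≤ ∑ n ∈ Finset.Ico 1 T, (6 * a / (n : ℝ)) ^ (2 / 3 : ℝ) := by
              refine Finset.sum_le_sum fun n _ => ?_
              rw [hε, div_one]
              exact min_one_le_rpow (by positivity)
          _ ≤ ∑ n ∈ Finset.Ico 1 (T + 1), (6 * a / (n : ℝ)) ^ (2 / 3 : ℝ) :=
              Finset.sum_le_sum_of_subset_of_nonneg (Finset.Ico_subset_Ico_right T.le_succ)
                fun n _ _ => by positivity
          _ ≤ 3 * ((6 * a) ^ (2 / 3 : ℝ) * (T : ℝ) ^ (1 / 3 : ℝ)) :=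
              sum_rpow_two_thirds_le (by positivity) T
          _ ≤ 3 * (4 * P) := by
              gcongr 3 * ?_
              exact six_mul_rpow_le ha0 hθ1 ht0 hl
          _ = 12 * P := by ring
      have h6 := mul_le_mul_of_nonneg_left h5 (show 0 ≤ 20 / τ by positivity)
      have h7 : 20 / τ * (12 * P) = 240 * (1 / τ * P) := by ring
      have h8 := one_le_two_mul_rate ha1 hθ1 hT0 hl
      have h9 : P ≤ 1 / τ * P := by
        refine le_mul_of_one_le_left hP0 ?_
        rw [le_div_iff₀ hτ0]
        linarith
      rw [← hP] at h8
      linarith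

end IsRun

end Final

end ActiveGreedy

end

open MeasureTheory ProbabilityTheory ActiveGreedy in
theorem mainTheorem1 :
    ∃ C : ℝ, 0 < C ∧
      -- high-probability event and regret bound for every exploration parameter
      (∀ (K T : ℕ) (δ ε τ : ℝ), 2 ≤ T → 0 < δ → δ < 1 → 0 < ε → ε ≤ 1 →
        ∀ (X : Type*) [MeasurableSpace X] (B : Problem X K), B.Massart τ →
        ∀ (Ω : Type*) [mΩ : MeasurableSpace Ω] (μ : Measure Ω) [IsProbabilityMeasure μ]
          (𝓕 : Filtration ℕ mΩ) (S : Ω → Transcript X K), IsRun B ε δ μ 𝓕 S →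
          1 - δ ≤ μ.real (goodEvent B ε δ S) ∧
          ∫ ω, (S ω).regret B.opt T ∂μ[|goodEvent B ε δ S] ≤
            C * (K * Real.log (T * B.Pol.card / δ) / (τ * ε) * Real.log T
              + B.disCoeff / τ *
                Real.sqrt (ε * K * T * Real.log (T * B.Pol.card / δ)))) ∧
      -- tuned exploration parameter, which depends only on `K`, `|Π|`, `T`, `δ` and `θ`
      (∀ (K N T : ℕ) (δ θ : ℝ), 2 ≤ T → 0 < δ → δ < 1 →
        ∃ ε : ℝ, 0 < ε ∧ ε ≤ 1 ∧
        ∀ (X : Type*) [MeasurableSpace X] (B : Problem X K), B.Pol.card = N → B.disCoeff = θ →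
        ∀ τ : ℝ, B.Massart τ →
        ∀ (Ω : Type*) [mΩ : MeasurableSpace Ω] (μ : Measure Ω) [IsProbabilityMeasure μ]
          (𝓕 : Filtration ℕ mΩ) (S : Ω → Transcript X K), IsRun B ε δ μ 𝓕 S →
          ∫ ω, (S ω).regret B.opt T ∂μ[|goodEvent B ε δ S] ≤
            C * (1 / τ * (θ * K * Real.log (T * N / δ)) ^ (2 / 3 : ℝ)
              * (T * Real.log T) ^ (1 / 3 : ℝ))) := by
  refine ⟨1452, by norm_num, ?_, ?_⟩
  · intro K T δ ε τ hT hδ hδ1 hε hε1 X _ B hτ Ω _ μ _ 𝓕 S h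
    refine ⟨by linarith [h.measureReal_goodEvent_ge hε hε1 hδ hδ1], ?_⟩
    refine (h.integral_regret_cond_le_of_massart hε hε1 hδ hδ1 hτ hT).trans ?_
    refine mul_le_mul_of_nonneg_right (by norm_num) ?_
    have hτ0 := hτ.1
    have hθ := B.disCoeff_nonneg
    have hL := (Real.log_nonneg (by norm_num)).trans
      (log_two_le_log_div hT B.one_le_card hδ hδ1)
    positivity
  · intro K N T δ θ hT hδ hδ1
    -- The parameter is fixed before the problem. When θ = 0 the balanced formula divides by zero
    -- and evaluates to 0, and the default 1 takes over.
    refine ⟨tunedParam K N T δ θ, tunedParam_pos _ _ _ _ _, tunedParam_le_one _ _ _ _ _, ?_⟩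
    intro X _ B hN hθ τ hτ Ω _ μ _ 𝓕 S h
    subst hN hθ
    exact IsRun.integral_regret_cond_le_of_tuned hδ hδ1 hτ hT rfl h
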